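/- \textbf{Model.} Let $p\in\mathbb N$, let ${\cal X}$ be a compact metric space, and let $\Theta\subseteq\mathbb R^p$ be compact. Let $\mu:{\cal X}\times\Theta\to\mathbb R$ be continuous, and let $f_\theta:{\cal X}\to\mathbb R^p$, $\theta\in\Theta$, be such that $(x,\theta)\mapsto f_\theta(x)$ is continuous and, for each $\theta\in\Theta$, the image $f_\theta({\cal X})$ spans $\mathbb R^p$. Let $P_\tau$, $\tau\in J$, be a one-parameter exponential family on $\mathbb R$ in canonical form: $J\subseteq\mathbb R$ is an open interval, and $P_\tau$ is a probability measure with density $K(y)\exp(\tau y-b(\tau))$ with respect to a Borel measure $\nu$ on $\mathbb R$, where $K\ge 0$ is measurable and $b:J\to\mathbb R$. Assume that $P_\tau$ has positive variance for every $\tau\in J$. (Then $b$ is infinitely differentiable and $b'$ is injective on $J$; let $(b')^{-1}:b'(J)\to J$ be its inverse.) Condition (GLM$^*$) with the Fisher-information weight: there are a continuous function $\psi:{\cal X}\times\Theta\to(0,\infty)$, a continuous function $f:{\cal X}\to\mathbb R^p$, an open interval $I\subseteq\mathbb R$, and a continuously differentiable function $G:I\to\mathbb R$ with $G'>0$ and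 $G(I)\subseteq b'(J)$ such that, for all $(x,\theta)\in{\cal X}\times\Theta$, \[ f_\theta(x)=\psi(x,\theta)f(x),\qquad f(x)^{\sf T}\theta\in I,\qquad \mu(x,\theta)=G\bigl(f(x)^{\sf T}\theta\bigr),\qquad \psi(x,\theta)=\varphi\bigl(f(x)^{\sf T}\theta\bigr), \] where $\varphi(u)=G'(u)\big/\sqrt{b''\bigl((b')^{-1}(G(u))\bigr)}$, $u\in I$. For $(x,\theta)\in{\cal X}\times\Theta$ put $\tau(x,\theta)=(b')^{-1}\bigl(G(f(x)^{\sf T}\theta)\bigr)$. \textbf{Stochastic model.} Let $n_1\in\mathbb N$, $n_0=0$, and $n_k=n_1+(k-1)p$ for $k\ge1$. Let $\overline\theta\in\Theta$ be the true parameter point. Let $X_i$ (with values in ${\cal X}$) and $Y_i$ (real-valued), $i\ge1$, be random variables on a probability space $(\Omega,{\cal F},\mathbb P_{\overline\theta})$, and let ${\cal F}_0\subseteq{\cal F}_1\subseteq\cdots$ be sub-$\sigma$-fields of ${\cal F}$ such that for every $k\ge1$: (a1) $(X_{n_{k-1}+1},\dots,X_{n_k})$ is ${\cal F}_{k-1}$-measurable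 and $(Y_{n_{k-1}+1},\dots,Y_{n_k})$ is ${\cal F}_k$-measurable; (a2$'$) the conditional distribution of $(Y_{n_{k-1}+1},\dots,Y_{n_k})$ given ${\cal F}_{k-1}$ is the product of the distributions $P_{\tau(X_i,\overline\theta)}$, $n_{k-1}+1\le i\le n_k$. \textbf{$p$-step-ahead algorithm.} Let $\widehat\theta_k:({\cal X}\times\mathbb R)^{n_k}\to\Theta$, $k\ge1$, be arbitrary functions (the estimators employed by the algorithm). Assume that almost surely, for every $k\ge1$, with $\theta_k=\widehat\theta_k(X_1,Y_1,\dots,X_{n_k},Y_{n_k})$, \[ \bigl(\det[f_{\theta_k}(X_{n_k+1}),\dots,f_{\theta_k}(X_{n_k+p})]\bigr)^2=\max_{z_1,\dots,z_p\in{\cal X}}\bigl(\det[f_{\theta_k}(z_1),\dots,f_{\theta_k}(z_p)]\bigr)^2 . \] \textbf{Conclusion.} For each $k\ge1$ let $\widehat\theta^{(\mathrm{ML})}_k:({\cal X}\times\mathbb R)^{n_k}\to\Theta$ be a maximum likelihood estimator, that is, for all data its value maximizes over $\theta\in\Theta$ the log-likelihood \[ L_{n_k}(\theta)=\sum_{i=1}^{n_k}\Bigl(\log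 K(y_i)+\tau(x_i,\theta)\,y_i-b\bigl(\tau(x_i,\theta)\bigr)\Bigr) \] (the term $\log K(y_i)$, which does not depend on $\theta$, is read as $0$ if $K(y_i)=0$). Then the adaptive maximum likelihood estimators are strongly consistent: \[ \widehat\theta^{(\mathrm{ML})}_k(X_1,Y_1,\dots,X_{n_k},Y_{n_k})\longrightarrow\overline\theta\quad\text{almost surely as }k\to\infty . \] -/

import Mathlib

open MeasureTheory ProbabilityTheory Filter Topology

noncomputable section

namespace AdaptiveGLM

/-! ### The regression model -/

/-- Data of a regression model with experimental region `𝒳` and parameter space `Θ ⊆ ℝ^p`: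
mean response `mu x θ` and the `ℝ^p`-valued functions `reg θ` (written `f_θ`), where
`f_θ(x) f_θ(x)ᵀ` is the elemental information matrix of `x` at `θ`.
Only the values at parameters `θ ∈ Θ` matter. -/
structure RegressionModel (𝒳 : Type*) (p : ℕ) where
  /-- the parameter space -/
  Θ : Set (EuclideanSpace ℝ (Fin p))
  /-- the mean response function -/
  mu : 𝒳 → EuclideanSpace ℝ (Fin p) → ℝ
  /-- the family of functions `f_θ` -/
  reg : EuclideanSpace ℝ (Fin p) → 𝒳 → EuclideanSpace ℝ (Fin p)

/-- The basic conditions on a regression model (compactness of the metric space `𝒳` is a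
type-class assumption of the theorem). -/
structure RegressionModel.Basic {𝒳 : Type*} [TopologicalSpace 𝒳] {p : ℕ}
    (M : RegressionModel 𝒳 p) : Prop where
  isCompact_Θ : IsCompact M.Θ
  continuousOn_mu :
    ContinuousOn (fun q : 𝒳 × EuclideanSpace ℝ (Fin p) => M.mu q.1 q.2) (Set.univ ×ˢ M.Θ)
  span_reg : ∀ θ ∈ M.Θ, Submodule.span ℝ (Set.range (M.reg θ)) = ⊤
  continuousOn_reg :
    ContinuousOn (fun q : 𝒳 × EuclideanSpace ℝ (Fin p) => M.reg q.2 q.1) (Set.univ ×ˢ M.Θ)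

/-- Condition (GLM): `f_θ(x) = ψ(x, θ) f(x)` with continuous `ψ > 0` and continuous `f`. -/
structure RegressionModel.GLM {𝒳 : Type*} [TopologicalSpace 𝒳] {p : ℕ}
    (M : RegressionModel 𝒳 p) (ψ : 𝒳 → EuclideanSpace ℝ (Fin p) → ℝ)
    (f : 𝒳 → EuclideanSpace ℝ (Fin p)) : Prop where
  continuousOn_ψ :
    ContinuousOn (fun q : 𝒳 × EuclideanSpace ℝ (Fin p) => ψ q.1 q.2) (Set.univ ×ˢ M.Θ)
  ψ_pos : ∀ x, ∀ θ ∈ M.Θ, 0 < ψ x θ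
  continuous_f : Continuous f
  reg_eq : ∀ x, ∀ θ ∈ M.Θ, M.reg θ x = ψ x θ • f x

/-- Condition (GLM*): (GLM) holds and `mu(x, θ) = G(f(x)ᵀ θ)`, where `G` is continuously
differentiable with positive derivative on an open interval `I` that contains all `f(x)ᵀ θ`. -/
structure RegressionModel.GLMStar {𝒳 : Type*} [TopologicalSpace 𝒳] {p : ℕ}
    (M : RegressionModel 𝒳 p) (ψ : 𝒳 → EuclideanSpace ℝ (Fin p) → ℝ)
    (f : 𝒳 → EuclideanSpace ℝ (Fin p)) (I : Set ℝ) (G : ℝ → ℝ) : Prop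
    extends M.GLM ψ f where
  isOpen_I : IsOpen I
  ordConnected_I : I.OrdConnected
  contDiffOn_G : ContDiffOn ℝ 1 G I
  deriv_G_pos : ∀ u ∈ I, 0 < deriv G u
  mem_I : ∀ x, ∀ θ ∈ M.Θ, inner ℝ (f x) θ ∈ I
  mu_eq : ∀ x, ∀ θ ∈ M.Θ, M.mu x θ = G (inner ℝ (f x) θ)

/-! ### One-parameter exponential families -/

/-- The measure with density `y ↦ K(y) exp(τ y - b(τ))` with respect to `ν`. -/
def canonicalMeasure (ν : Measure ℝ) (K b : ℝ → ℝ) (τ : ℝ) : Measure ℝ :=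
  ν.withDensity fun y => ENNReal.ofReal (K y * Real.exp (τ * y - b τ))

/-- A one-parameter exponential family `P_τ`, `τ ∈ J`, in canonical form on the real line, with
non-degenerate members. -/
structure ExpFamily where
  /-- the open interval of canonical parameters -/
  J : Set ℝ
  /-- the dominating Borel measure -/
  ν : Measure ℝ
  /-- the factor of the density that does not depend on the parameter -/
  K : ℝ → ℝ
  /-- the log-normalizer -/
  b : ℝ → ℝ
  isOpen_J : IsOpen J
  ordConnected_J : J.OrdConnected
  measurable_K : Measurable K
  K_nonneg : ∀ y, 0 ≤ K y
  isProbabilityMeasure : ∀ τ ∈ J, IsProbabilityMeasure (canonicalMeasure ν K b τ)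
  variance_pos : ∀ τ ∈ J, 0 < variance (fun y : ℝ => y) (canonicalMeasure ν K b τ)

/-- The member `P_τ` of the family. -/
def ExpFamily.P (E : ExpFamily) (τ : ℝ) : Measure ℝ := canonicalMeasure E.ν E.K E.b τ

/-- The inverse `(b')⁻¹ : b'(J) → J`. -/
def ExpFamily.derivInv (E : ExpFamily) (m : ℝ) : ℝ := Function.invFunOn (deriv E.b) E.J m

/-- The weight function `φ(u) = G'(u) / √(b''((b')⁻¹(G(u))))`. -/
def ExpFamily.fisherWeight (E : ExpFamily) (G : ℝ → ℝ) (u : ℝ) : ℝ :=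
  deriv G u / Real.sqrt (deriv (deriv E.b) (E.derivInv (G u)))

/-- The canonical parameter `(b')⁻¹(G(f(x)ᵀ θ))` of the response at `x` under `θ`. -/
def ExpFamily.canonicalParam (E : ExpFamily) {𝒳 : Type*} {p : ℕ}
    (G : ℝ → ℝ) (f : 𝒳 → EuclideanSpace ℝ (Fin p)) (x : 𝒳)
    (θ : EuclideanSpace ℝ (Fin p)) : ℝ :=
  E.derivInv (G (inner ℝ (f x) θ))

/-! ### The `p`-step-ahead algorithm

Design points and responses are numbered from `0`, so that batch number `k ≥ 1` consists of the
indices `i` with `n_{k-1} ≤ i < n_k`, and the data after batch `k` are those with `i < n_k`. -/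

/-- The sample sizes: `n_0 = 0` and `n_k = n₁ + (k - 1) p` for `k ≥ 1`. -/
def sampleSize (n₁ p : ℕ) : ℕ → ℕ
  | 0 => 0
  | k + 1 => n₁ + k * p

/-- The first `m` data `(x_i, y_i)` of a path. -/
def dataUpTo {𝒳 : Type*} (x : ℕ → 𝒳) (y : ℕ → ℝ) (m : ℕ) : Fin m → 𝒳 × ℝ :=
  fun i => (x i, y i)

/-- The matrix with columns `f_θ(z_1), …, f_θ(z_p)`. -/
def RegressionModel.regMatrix {𝒳 : Type*} {p : ℕ} (M : RegressionModel 𝒳 p)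
    (θ : EuclideanSpace ℝ (Fin p)) (z : Fin p → 𝒳) : Matrix (Fin p) (Fin p) ℝ :=
  Matrix.of fun i j => M.reg θ (z j) i

/-- The path `(x, y)` is generated by the `p`-step-ahead algorithm which starts with `n₁` points
and employs the estimators `est k`: for every `k ≥ 1` the batch that follows the first `n_k`
points maximizes `(det [f_θ(z_1), …, f_θ(z_p)])²` over `z_1, …, z_p ∈ 𝒳`, where `θ` is the value
of `est k` at the first `n_k` data. -/
def RegressionModel.IsAlgorithmPath {𝒳 : Type*} {p : ℕ} (M : RegressionModel 𝒳 p) (n₁ : ℕ)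
    (est : (k : ℕ) → (Fin (sampleSize n₁ p k) → 𝒳 × ℝ) → EuclideanSpace ℝ (Fin p))
    (x : ℕ → 𝒳) (y : ℕ → ℝ) : Prop :=
  ∀ k, 1 ≤ k → ∀ z : Fin p → 𝒳,
    (M.regMatrix (est k (dataUpTo x y (sampleSize n₁ p k))) z).det ^ 2 ≤
      (M.regMatrix (est k (dataUpTo x y (sampleSize n₁ p k)))
        (fun j => x (sampleSize n₁ p k + j))).det ^ 2

/-! ### The stochastic model -/

/-- Assumption (a1): batch `k + 1` of the design points is `ℱ k`-measurable, and batch `k + 1` of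
the responses is `ℱ (k + 1)`-measurable. -/
def A1 {𝒳 Ω : Type*} [MeasurableSpace 𝒳] {mΩ : MeasurableSpace Ω} (n₁ p : ℕ)
    (ℱ : Filtration ℕ mΩ) (X : ℕ → Ω → 𝒳) (Y : ℕ → Ω → ℝ) : Prop :=
  ∀ k, ∀ i ∈ Finset.Ico (sampleSize n₁ p k) (sampleSize n₁ p (k + 1)),
    Measurable[ℱ k] (X i) ∧ Measurable[ℱ (k + 1)] (Y i)

/-- Assumption (a2'): the conditional distribution of batch `k + 1` of the responses given `ℱ k`
is the product of the distributions `P_{τ_i}`, where `τ_i` is the canonical parameter at the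
design point `X_i` under the true parameter `θbar`. -/
def A2' {𝒳 Ω : Type*} {mΩ : MeasurableSpace Ω} {p : ℕ} (μ : Measure Ω) (n₁ : ℕ)
    (ℱ : Filtration ℕ mΩ) (X : ℕ → Ω → 𝒳) (Y : ℕ → Ω → ℝ) (E : ExpFamily) (G : ℝ → ℝ)
    (f : 𝒳 → EuclideanSpace ℝ (Fin p)) (θbar : EuclideanSpace ℝ (Fin p)) : Prop :=
  ∀ k, ∀ B : Set (↥(Finset.Ico (sampleSize n₁ p k) (sampleSize n₁ p (k + 1))) → ℝ),
    MeasurableSet B →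
      μ⟦{ω | (fun i : ↥(Finset.Ico (sampleSize n₁ p k) (sampleSize n₁ p (k + 1))) =>
          Y i ω) ∈ B} | ℱ k⟧
        =ᵐ[μ] fun ω => (Measure.pi fun i : ↥(Finset.Ico (sampleSize n₁ p k)
          (sampleSize n₁ p (k + 1))) => E.P (E.canonicalParam G f (X i ω) θbar)).real B

/-- The log-likelihood `∑ i, (log K(y_i) + τ_i(θ) y_i - b(τ_i(θ)))` of the data `d`. -/
def ExpFamily.logLikelihood (E : ExpFamily) {𝒳 : Type*} {p m : ℕ} (G : ℝ → ℝ)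
    (f : 𝒳 → EuclideanSpace ℝ (Fin p)) (d : Fin m → 𝒳 × ℝ)
    (θ : EuclideanSpace ℝ (Fin p)) : ℝ :=
  ∑ i, (Real.log (E.K (d i).2) + E.canonicalParam G f (d i).1 θ * (d i).2
    - E.b (E.canonicalParam G f (d i).1 θ))

/-- The maps `ml k` are maximum likelihood estimators: for every `k ≥ 1` and all data, `ml k`
maximizes the log-likelihood of the data over `Θ`. -/
def RegressionModel.IsMLE {𝒳 : Type*} {p : ℕ} (M : RegressionModel 𝒳 p) (n₁ : ℕ)
    (E : ExpFamily) (G : ℝ → ℝ) (f : 𝒳 → EuclideanSpace ℝ (Fin p))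
    (ml : (k : ℕ) → (Fin (sampleSize n₁ p k) → 𝒳 × ℝ) → EuclideanSpace ℝ (Fin p)) : Prop :=
  ∀ k, 1 ≤ k → ∀ d, ml k d ∈ M.Θ ∧ IsMaxOn (E.logLikelihood G f d) M.Θ (ml k d)

end AdaptiveGLM

end

/-!
Strong consistency of the adaptive maximum likelihood estimators.

Write `t(x, θ)` for the canonical parameter of the response at `x` under `θ`, and `e_i` for the
error `Y_i - b'(t(X_i, θbar))`. The loss of log-likelihood at `θ` against the true parameter is
`∑ D(t(X_i, θbar), t(X_i, θ)) - ∑ (t(X_i, θ) - t(X_i, θbar)) e_i`, where `D` is the Kullback-Leibler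
divergence of the exponential family (`ExpFamily.logLikelihood_sub`). At a maximizer this loss is
not positive, so consistency follows once, for `θ` outside a ball around `θbar`, the first sum grows
linearly in the number `k` of batches while the second is `o(k)` uniformly in `θ`.

The divergences. The base measure with density `K` turns `b` into a cumulant generating function, so
`b` is analytic on `J`, with the mean and the variance of `P_τ` as its first two derivatives. Hence
`b` is strictly convex and `D(τ, σ) > 0` for `τ ≠ σ`. Since `f_θ` is a positive multiple of `f`,
bounded above and below on the compact set `𝒳 × Θ`, a batch chosen by the algorithm has
`(det [f(x_1), …, f(x_p)])²` bounded away from zero, whatever the value of the estimator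
(`RegressionModel.GLM.exists_le_det_sq`). Such a batch identifies the parameter, and compactness
gives a positive lower bound for the sum of its divergences when `θ` stays away from `θbar`
(`RegressionModel.GLMStar.exists_le_sum_klDiv`).

The errors. For fixed weights the batch sums of the weighted errors are conditionally centred given
the past, so they are orthogonal with bounded second moments, and the strong law for orthogonal
sequences applies (`ae_tendsto_sum_batches`); it needs no independence. The same law applied to the
centred absolute errors bounds the averages of `|e_i|`.
Uniformity in `θ` then follows from a finite net of `Θ` and uniform continuity of `t`
(`ExpFamily.ae_eventually_forall_sum_mul_error_le`).
-/

namespace AdaptiveGLM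

/-! ### The exponential family -/

namespace ExpFamily

variable (E : ExpFamily)

/-- The measure with density `K` with respect to `ν`. It generates the family: `P_τ` is its
exponential tilting by `τ`, and `b` agrees on `J` with its cumulant generating function. -/
noncomputable def baseMeasure : Measure ℝ := E.ν.withDensity fun y => ENNReal.ofReal (E.K y)

lemma P_eq_withDensity (τ : ℝ) :
    E.P τ = E.baseMeasure.withDensity fun y => ENNReal.ofReal (Real.exp (τ * y - E.b τ)) := by
  have hK : Measurable fun y => ENNReal.ofReal (E.K y) := E.measurable_K.ennreal_ofReal
  have he : Measurable fun y : ℝ => ENNReal.ofReal (Real.exp (τ * y - E.b τ)) := by fun_prop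
  rw [P, canonicalMeasure, baseMeasure, ← withDensity_mul _ hK he]
  congr 1
  ext y
  exact ENNReal.ofReal_mul (E.K_nonneg y)

variable {E} {τ : ℝ}

lemma lintegral_exp_baseMeasure (hτ : τ ∈ E.J) :
    ∫⁻ y, ENNReal.ofReal (Real.exp (τ * y)) ∂E.baseMeasure = ENNReal.ofReal (Real.exp (E.b τ)) := by
  have h1 : E.P τ Set.univ = 1 := (E.isProbabilityMeasure τ hτ).measure_univ
  rw [P_eq_withDensity, withDensity_apply _ MeasurableSet.univ, Measure.restrict_univ] at h1
  have h2 : ∀ y : ℝ, ENNReal.ofReal (Real.exp (τ * y)) =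
      ENNReal.ofReal (Real.exp (E.b τ)) * ENNReal.ofReal (Real.exp (τ * y - E.b τ)) := by
    intro y
    rw [← ENNReal.ofReal_mul (Real.exp_pos _).le, ← Real.exp_add]
    congr 2
    ring
  simp_rw [h2]
  rw [lintegral_const_mul _ (by fun_prop), h1, mul_one]

lemma integrable_exp_baseMeasure (hτ : τ ∈ E.J) :
    Integrable (fun y : ℝ => Real.exp (τ * y)) E.baseMeasure := by
  refine ⟨by fun_prop, ?_⟩
  rw [hasFiniteIntegral_iff_ofReal (ae_of_all _ fun y => (Real.exp_pos _).le),
    lintegral_exp_baseMeasure hτ]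
  exact ENNReal.ofReal_lt_top

lemma mgf_baseMeasure (hτ : τ ∈ E.J) :
    mgf (fun y : ℝ => y) E.baseMeasure τ = Real.exp (E.b τ) := by
  rw [mgf, integral_eq_lintegral_of_nonneg_ae (ae_of_all _ fun y => (Real.exp_pos _).le)
    (by fun_prop), lintegral_exp_baseMeasure hτ, ENNReal.toReal_ofReal (Real.exp_pos _).le]

lemma cgf_baseMeasure (hτ : τ ∈ E.J) : cgf (fun y : ℝ => y) E.baseMeasure τ = E.b τ := by
  rw [cgf, mgf_baseMeasure hτ, Real.log_exp]

lemma P_eq_tilted (hτ : τ ∈ E.J) : E.P τ = E.baseMeasure.tilted (fun y => τ * y) := by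
  have h : ∫ y, Real.exp (τ * y) ∂E.baseMeasure = Real.exp (E.b τ) := mgf_baseMeasure hτ
  rw [P_eq_withDensity, Measure.tilted, h]
  simp_rw [Real.exp_sub]

lemma mem_interior_integrableExpSet (hτ : τ ∈ E.J) :
    τ ∈ interior (integrableExpSet (fun y : ℝ => y) E.baseMeasure) :=
  mem_interior.2 ⟨E.J, fun _ h => integrable_exp_baseMeasure h, E.isOpen_J, hτ⟩

lemma b_eventuallyEq (hτ : τ ∈ E.J) : E.b =ᶠ[𝓝 τ] cgf (fun y : ℝ => y) E.baseMeasure := by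
  filter_upwards [E.isOpen_J.mem_nhds hτ] with s hs using (cgf_baseMeasure hs).symm

lemma analyticAt_b (hτ : τ ∈ E.J) : AnalyticAt ℝ E.b τ :=
  (analyticAt_cgf (mem_interior_integrableExpSet hτ)).congr (b_eventuallyEq hτ).symm

lemma continuousOn_b : ContinuousOn E.b E.J :=
  fun _ h => (analyticAt_b h).continuousAt.continuousWithinAt

lemma continuousOn_deriv_b : ContinuousOn (deriv E.b) E.J :=
  fun _ h => (analyticAt_b h).deriv.continuousAt.continuousWithinAt

lemma continuousOn_deriv_deriv_b : ContinuousOn (deriv (deriv E.b)) E.J :=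
  fun _ h => (analyticAt_b h).deriv.deriv.continuousAt.continuousWithinAt

lemma integral_P (hτ : τ ∈ E.J) : ∫ y, y ∂E.P τ = deriv E.b τ := by
  rw [P_eq_tilted hτ, (b_eventuallyEq hτ).deriv_eq]
  exact integral_tilted_mul_self (X := fun y : ℝ => y) (mem_interior_integrableExpSet hτ)

lemma variance_P (hτ : τ ∈ E.J) : Var[fun y => y; E.P τ] = deriv (deriv E.b) τ := by
  rw [P_eq_tilted hτ, (b_eventuallyEq hτ).deriv.deriv_eq]
  rw [variance_tilted_mul (X := fun y : ℝ => y) (mem_interior_integrableExpSet hτ),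
    iteratedDeriv_succ, iteratedDeriv_one]

lemma memLp_P (hτ : τ ∈ E.J) : MemLp (fun y : ℝ => y) 2 (E.P τ) := by
  rw [P_eq_tilted hτ]
  exact memLp_tilted_mul (X := fun y : ℝ => y) (mem_interior_integrableExpSet hτ) 2

lemma deriv_deriv_b_pos (hτ : τ ∈ E.J) : 0 < deriv (deriv E.b) τ := by
  rw [← variance_P hτ]
  exact E.variance_pos τ hτ

lemma convex_J : Convex ℝ E.J := E.ordConnected_J.convex

lemma strictMonoOn_deriv_b : StrictMonoOn (deriv E.b) E.J := by
  refine strictMonoOn_of_deriv_pos convex_J continuousOn_deriv_b fun τ hτ => ?_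
  exact deriv_deriv_b_pos (interior_subset hτ)

lemma strictConvexOn_b : StrictConvexOn ℝ E.J E.b := by
  refine StrictMonoOn.strictConvexOn_of_deriv convex_J continuousOn_b ?_
  exact strictMonoOn_deriv_b.mono interior_subset

/-- The Kullback-Leibler divergence `b(σ) - b(τ) - b'(τ) (σ - τ)` of `P_σ` from `P_τ`. -/
noncomputable def klDiv (E : ExpFamily) (τ σ : ℝ) : ℝ := E.b σ - E.b τ - deriv E.b τ * (σ - τ)

lemma klDiv_pos {σ : ℝ} (hτ : τ ∈ E.J) (hσ : σ ∈ E.J) (h : τ ≠ σ) : 0 < E.klDiv τ σ := by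
  have hd := (analyticAt_b hτ).differentiableAt
  rw [klDiv]
  rcases lt_or_gt_of_ne h with h | h
  · have := strictConvexOn_b.deriv_lt_slope hτ hσ h hd
    rw [slope_def_field, lt_div_iff₀ (sub_pos.2 h)] at this
    linarith
  · have := strictConvexOn_b.slope_lt_deriv hσ hτ h hd
    rw [slope_def_field, div_lt_iff₀ (sub_pos.2 h)] at this
    linarith

lemma klDiv_self : E.klDiv τ τ = 0 := by simp [klDiv]

lemma klDiv_nonneg {σ : ℝ} (hτ : τ ∈ E.J) (hσ : σ ∈ E.J) : 0 ≤ E.klDiv τ σ := by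
  rcases eq_or_ne τ σ with rfl | h
  · exact klDiv_self.ge
  · exact (klDiv_pos hτ hσ h).le

lemma derivInv_mem {m : ℝ} (hm : m ∈ deriv E.b '' E.J) : E.derivInv m ∈ E.J :=
  Function.invFunOn_mem hm

lemma deriv_b_derivInv {m : ℝ} (hm : m ∈ deriv E.b '' E.J) : deriv E.b (E.derivInv m) = m :=
  Function.invFunOn_eq hm

lemma injOn_derivInv : Set.InjOn E.derivInv (deriv E.b '' E.J) := fun m hm m' hm' h => by
  rw [← deriv_b_derivInv hm, h, deriv_b_derivInv hm']

lemma strictMonoOn_derivInv : StrictMonoOn E.derivInv (deriv E.b '' E.J) := fun m hm m' hm' h => by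
  rw [← strictMonoOn_deriv_b.lt_iff_lt (derivInv_mem hm) (derivInv_mem hm'),
    deriv_b_derivInv hm, deriv_b_derivInv hm']
  exact h

lemma image_derivInv : E.derivInv '' (deriv E.b '' E.J) = E.J := by
  refine Set.Subset.antisymm (Set.image_subset_iff.2 fun m hm => derivInv_mem hm) fun τ hτ => ?_
  have h : deriv E.b τ ∈ deriv E.b '' E.J := ⟨τ, hτ, rfl⟩
  exact ⟨deriv E.b τ, h, strictMonoOn_deriv_b.injOn (derivInv_mem h) hτ (deriv_b_derivInv h)⟩

/-- As `b''(τ) ≠ 0`, the inverse function theorem shows that `b'` is open at `τ`. -/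
lemma image_deriv_b_mem_nhds (hτ : τ ∈ E.J) : deriv E.b '' E.J ∈ 𝓝 (deriv E.b τ) := by
  have h := (analyticAt_b hτ).deriv.hasStrictDerivAt.map_nhds_eq (deriv_deriv_b_pos hτ).ne'
  rw [← h]
  exact image_mem_map (E.isOpen_J.mem_nhds hτ)

lemma continuousOn_derivInv : ContinuousOn E.derivInv (deriv E.b '' E.J) := by
  rintro _ ⟨τ, hτ, rfl⟩
  refine (strictMonoOn_derivInv.continuousAt_of_image_mem_nhds
    (image_deriv_b_mem_nhds hτ) ?_).continuousWithinAt
  rw [image_derivInv]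
  exact E.isOpen_J.mem_nhds (derivInv_mem ⟨τ, hτ, rfl⟩)

end ExpFamily

/-! ### A strong law of large numbers for orthogonal random variables -/

section StrongLaw

variable {Ω : Type*} {mΩ : MeasurableSpace Ω} {μ : Measure Ω}

/-- Random variables with summable second moments tend to zero almost surely. -/
lemma ae_tendsto_zero_of_summable_integral_sq {U : ℕ → Ω → ℝ} (hU : ∀ m, MemLp (U m) 2 μ)
    {c : ℕ → ℝ} (hc : Summable c) (hUc : ∀ m, ∫ ω, U m ω ^ 2 ∂μ ≤ c m) :
    ∀ᵐ ω ∂μ, Tendsto (fun m => U m ω) atTop (𝓝 0) := by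
  have h0 : ∀ m, 0 ≤ c m := fun m => (integral_nonneg fun ω => sq_nonneg (U m ω)).trans (hUc m)
  have hle : ∀ m, ∫⁻ ω, ENNReal.ofReal (U m ω ^ 2) ∂μ ≤ ENNReal.ofReal (c m) := fun m => by
    rw [← ofReal_integral_eq_lintegral_ofReal (hU m).integrable_sq
      (ae_of_all _ fun ω => sq_nonneg (U m ω))]
    exact ENNReal.ofReal_le_ofReal (hUc m)
  have hmeas : ∀ m, AEMeasurable (fun ω => ENNReal.ofReal (U m ω ^ 2)) μ := fun m =>
    ((hU m).aestronglyMeasurable.aemeasurable.pow_const 2).ennreal_ofReal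
  have hsum : ∫⁻ ω, ∑' m, ENNReal.ofReal (U m ω ^ 2) ∂μ ≠ ⊤ := by
    rw [lintegral_tsum hmeas]
    refine ne_top_of_le_ne_top ?_ (ENNReal.tsum_le_tsum hle)
    rw [← ENNReal.ofReal_tsum_of_nonneg h0 hc]
    exact ENNReal.ofReal_ne_top
  filter_upwards [ae_lt_top' (AEMeasurable.tsum hmeas) hsum] with ω hω
  have h1 := ENNReal.tendsto_atTop_zero_of_tsum_ne_top hω.ne
  have h2 : Tendsto (fun m => U m ω ^ 2) atTop (𝓝 0) := by
    have := (ENNReal.tendsto_toReal ENNReal.zero_ne_top).comp h1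
    simpa [Function.comp_def, ENNReal.toReal_ofReal, sq_nonneg] using this
  have h3 := h2.sqrt
  simp only [Real.sqrt_sq_eq_abs, Real.sqrt_zero] at h3
  exact (tendsto_zero_iff_abs_tendsto_zero _).2 h3

lemma integral_sq_sum_le_of_orthogonal {Z : ℕ → Ω → ℝ} (hZ : ∀ i, MemLp (Z i) 2 μ)
    (horth : ∀ i j, i < j → ∫ ω, Z i ω * Z j ω ∂μ = 0) {C : ℝ}
    (hC : ∀ i, ∫ ω, Z i ω ^ 2 ∂μ ≤ C) (n : ℕ) :
    ∫ ω, (∑ i ∈ Finset.range n, Z i ω) ^ 2 ∂μ ≤ n * C := by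
  induction n with
  | zero => simp
  | succ n ih =>
    have hS : MemLp (fun ω => ∑ i ∈ Finset.range n, Z i ω) 2 μ :=
      memLp_finsetSum _ fun i _ => hZ i
    have hcross : ∫ ω, (∑ i ∈ Finset.range n, Z i ω) * Z n ω ∂μ = 0 := by
      simp_rw [Finset.sum_mul]
      rw [integral_finsetSum _ fun i _ => show Integrable (fun ω => Z i ω * Z n ω) μ from
        (hZ i).integrable_mul (hZ n)]
      exact Finset.sum_eq_zero fun i hi => horth i n (Finset.mem_range.1 hi)
    have hexp : ∀ ω, (∑ i ∈ Finset.range (n + 1), Z i ω) ^ 2 =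
        (∑ i ∈ Finset.range n, Z i ω) ^ 2 + 2 * ((∑ i ∈ Finset.range n, Z i ω) * Z n ω)
          + Z n ω ^ 2 := fun ω => by
      rw [Finset.sum_range_succ]
      ring
    simp_rw [hexp]
    have hi1 := hS.integrable_sq
    have hi2 : Integrable (fun ω => 2 * ((∑ i ∈ Finset.range n, Z i ω) * Z n ω)) μ :=
      (hS.integrable_mul (hZ n)).const_mul 2
    have hi3 : Integrable (fun ω => (∑ i ∈ Finset.range n, Z i ω) ^ 2 +
        2 * ((∑ i ∈ Finset.range n, Z i ω) * Z n ω)) μ := hi1.add hi2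
    rw [integral_add hi3 (hZ n).integrable_sq, integral_add hi1 hi2,
      integral_const_mul, hcross]
    push_cast
    linarith [hC n]

/-- Strong law of large numbers for orthogonal random variables with bounded second moments. Along
the squares `n = m ^ 2` the averages have summable second moments, and so do the increments between
consecutive squares, divided by `m ^ 2`. -/
theorem ae_tendsto_average_of_orthogonal {Z : ℕ → Ω → ℝ} (hZ : ∀ i, MemLp (Z i) 2 μ)
    (horth : ∀ i j, i < j → ∫ ω, Z i ω * Z j ω ∂μ = 0) {C : ℝ}
    (hC : ∀ i, ∫ ω, Z i ω ^ 2 ∂μ ≤ C) :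
    ∀ᵐ ω ∂μ, Tendsto (fun n : ℕ => (∑ i ∈ Finset.range n, Z i ω) / n) atTop (𝓝 0) := by
  have hC0 : 0 ≤ C := (integral_nonneg fun ω => sq_nonneg (Z 0 ω)).trans (hC 0)
  let T : ℕ → Ω → ℝ := fun m ω => (∑ i ∈ Finset.range (m ^ 2), Z i ω) / (m : ℝ) ^ 2
  let R : ℕ → Ω → ℝ := fun m ω =>
    (∑ i ∈ Finset.Ico (m ^ 2) ((m + 1) ^ 2), |Z i ω|) / (m : ℝ) ^ 2
  have hTL : ∀ m, MemLp (T m) 2 μ := fun m => by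
    simp only [T, div_eq_inv_mul]
    exact (memLp_finsetSum _ fun i _ => hZ i).const_mul _
  have hRL : ∀ m, MemLp (R m) 2 μ := fun m => by
    simp only [R, div_eq_inv_mul]
    exact (memLp_finsetSum _ fun i _ => (hZ i).abs).const_mul _
  -- The factor `9` is needed for the increments `R m`, through `(2 m + 1)² ≤ (3 m)²`.
  have hs : Summable fun m : ℕ => 9 * C * (1 / (m : ℝ) ^ 2) :=
    (Real.summable_one_div_nat_pow.2 one_lt_two).mul_left _
  have hT : ∀ᵐ ω ∂μ, Tendsto (fun m => T m ω) atTop (𝓝 0) := by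
    refine ae_tendsto_zero_of_summable_integral_sq hTL hs fun m => ?_
    simp only [T, div_pow]
    rw [integral_div]
    rcases Nat.eq_zero_or_pos m with rfl | hm
    · simp
    · have hm' : (0 : ℝ) < m := by exact_mod_cast hm
      have := integral_sq_sum_le_of_orthogonal hZ horth hC (m ^ 2)
      rw [div_le_iff₀ (by positivity)]
      push_cast at this
      refine this.trans ?_
      have : 9 * C * (1 / (m : ℝ) ^ 2) * ((m : ℝ) ^ 2) ^ 2 = 9 * ((m : ℝ) ^ 2 * C) := by
        field_simp
      rw [this]
      nlinarith [mul_nonneg (sq_nonneg (m : ℝ)) hC0]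
  have hR : ∀ᵐ ω ∂μ, Tendsto (fun m => R m ω) atTop (𝓝 0) := by
    refine ae_tendsto_zero_of_summable_integral_sq hRL hs fun m => ?_
    simp only [R, div_pow]
    rw [integral_div]
    rcases Nat.eq_zero_or_pos m with rfl | hm
    · simp
    · have hm' : (1 : ℝ) ≤ m := by exact_mod_cast hm
      have hcard : ((Finset.Ico (m ^ 2) ((m + 1) ^ 2)).card : ℝ) = 2 * m + 1 := by
        rw [Nat.card_Ico, Nat.cast_sub (by gcongr; omega)]
        push_cast
        ring
      have hpt : ∀ ω, (∑ i ∈ Finset.Ico (m ^ 2) ((m + 1) ^ 2), |Z i ω|) ^ 2 ≤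
          (2 * m + 1) * ∑ i ∈ Finset.Ico (m ^ 2) ((m + 1) ^ 2), Z i ω ^ 2 := fun ω => by
        have := sq_sum_le_card_mul_sum_sq (s := Finset.Ico (m ^ 2) ((m + 1) ^ 2))
          (f := fun i => |Z i ω|)
        simpa only [sq_abs, hcard] using this
      have hint : Integrable (fun ω => (2 * (m : ℝ) + 1) *
          ∑ i ∈ Finset.Ico (m ^ 2) ((m + 1) ^ 2), Z i ω ^ 2) μ :=
        (integrable_finsetSum _ fun i _ => (hZ i).integrable_sq).const_mul _
      have h1 := integral_mono (memLp_finsetSum (Finset.Ico (m ^ 2) ((m + 1) ^ 2))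
        fun i _ => (hZ i).abs).integrable_sq hint hpt
      rw [integral_const_mul, integral_finsetSum _ fun i _ => (hZ i).integrable_sq] at h1
      have h2 : ∑ i ∈ Finset.Ico (m ^ 2) ((m + 1) ^ 2), ∫ ω, Z i ω ^ 2 ∂μ ≤ (2 * m + 1) * C := by
        rw [← hcard, ← nsmul_eq_mul]
        exact Finset.sum_le_card_nsmul _ _ _ fun i _ => hC i
      rw [div_le_iff₀ (by positivity)]
      have h3 : 9 * C * (1 / (m : ℝ) ^ 2) * ((m : ℝ) ^ 2) ^ 2 = (3 * m) * ((3 * m) * C) := by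
        field_simp
        ring
      rw [h3]
      calc _ ≤ _ := h1
        _ ≤ (2 * m + 1) * ((2 * m + 1) * C) := by gcongr
        _ ≤ (3 * m) * ((3 * m) * C) := by
          have : 2 * (m : ℝ) + 1 ≤ 3 * m := by linarith
          gcongr
  have hsqrt : Tendsto Nat.sqrt atTop atTop := by
    refine tendsto_atTop.2 fun b => ?_
    filter_upwards [eventually_ge_atTop (b ^ 2)] with n hn
    exact Nat.le_sqrt'.2 hn
  -- Between the squares `m² ≤ n < (m + 1)²`, with `m = √n`, the average is at most `|T m| + R m`.
  filter_upwards [hT, hR] with ω hTω hRω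
  have hlim : Tendsto (fun n : ℕ => |T n.sqrt ω| + R n.sqrt ω) atTop (𝓝 0) := by
    simpa [Function.comp_def] using (hTω.abs.add hRω).comp hsqrt
  refine squeeze_zero_norm' ?_ hlim
  filter_upwards [eventually_ge_atTop 1] with n hn
  have hm1 : n.sqrt ^ 2 ≤ n := Nat.sqrt_le' n
  have hm2 : n ≤ (n.sqrt + 1) ^ 2 := (Nat.lt_succ_sqrt' n).le
  have hm : (0 : ℝ) < (n.sqrt : ℝ) ^ 2 := by
    have : 0 < n.sqrt := Nat.sqrt_pos.2 hn
    positivity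
  have hmn : ((n.sqrt : ℝ)) ^ 2 ≤ n := by exact_mod_cast hm1
  rw [Real.norm_eq_abs, abs_div, Nat.abs_cast]
  simp only [T, R]
  rw [abs_div, abs_of_pos hm, ← add_div]
  refine div_le_div₀ (by positivity) ?_ hm hmn
  rw [← Finset.sum_range_add_sum_Ico _ hm1]
  refine (abs_add_le _ _).trans (add_le_add le_rfl ?_)
  refine (Finset.abs_sum_le_sum_abs _ _).trans ?_
  exact Finset.sum_le_sum_of_subset_of_nonneg (Finset.Ico_subset_Ico_right hm2)
    fun _ _ _ => abs_nonneg _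

end StrongLaw

/-! ### Responses with prescribed conditional distributions -/

section ConditionalLaw

variable {𝒳 Ω β : Type*} [MeasurableSpace 𝒳] [MeasurableSpace β] {m mΩ : MeasurableSpace Ω}
  {μ : Measure Ω} [IsProbabilityMeasure μ] {κ : Kernel 𝒳 ℝ} [IsMarkovKernel κ]

/-- If `V` has conditional distribution `κ (U ·)` given `m`, and if `U` and `W` are `m`-measurable,
then the joint distribution of `((W, U), V)` is that of `(W, U)` followed by the kernel `κ`. -/
lemma map_eq_compProd_of_condExp (hm : m ≤ mΩ) {W : Ω → β} {U : Ω → 𝒳} {V : Ω → ℝ}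
    (hW : Measurable[m] W) (hU : Measurable[m] U) (hV : Measurable V)
    (hcond : ∀ B, MeasurableSet B → μ⟦V ⁻¹' B | m⟧ =ᵐ[μ] fun ω => (κ (U ω)).real B) :
    μ.map (fun ω => ((W ω, U ω), V ω)) =
      (μ.map fun ω => (W ω, U ω)) ⊗ₘ (κ.prodMkLeft β) := by
  have hWU : Measurable[m] fun ω => (W ω, U ω) := hW.prodMk hU
  have hWU' : Measurable fun ω => (W ω, U ω) := hWU.mono hm le_rfl
  have : IsProbabilityMeasure (μ.map fun ω => (W ω, U ω)) :=
    Measure.isProbabilityMeasure_map hWU'.aemeasurable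
  have : IsProbabilityMeasure (μ.map fun ω => ((W ω, U ω), V ω)) :=
    Measure.isProbabilityMeasure_map (hWU'.prodMk hV).aemeasurable
  refine Measure.ext_prod fun {A B} hA hB => ?_
  rw [Measure.map_apply (hWU'.prodMk hV) (hA.prod hB), Measure.compProd_apply_prod hA hB,
    setLIntegral_map hA (Kernel.measurable_coe _ hB) hWU']
  have hpre : (fun ω => ((W ω, U ω), V ω)) ⁻¹' A ×ˢ B =
      V ⁻¹' B ∩ (fun ω => (W ω, U ω)) ⁻¹' A := by
    ext ω
    simp [and_comm]
  have hAm : MeasurableSet[m] ((fun ω => (W ω, U ω)) ⁻¹' A) := hWU hA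
  have hint : ∫ ω in (fun ω => (W ω, U ω)) ⁻¹' A, (κ (U ω)).real B ∂μ =
      μ.real (V ⁻¹' B ∩ (fun ω => (W ω, U ω)) ⁻¹' A) := by
    rw [← integral_congr_ae (ae_restrict_of_ae (hcond B hB)),
      setIntegral_condExp hm ((integrable_const 1).indicator (hV hB)) hAm,
      integral_indicator_const _ (hV hB), smul_eq_mul, mul_one, measureReal_restrict_apply (hV hB)]
  rw [hpre, ← ofReal_measureReal, ← hint, ofReal_integral_eq_lintegral_ofReal]
  · refine lintegral_congr fun ω => ?_
    rw [ofReal_measureReal, Kernel.prodMkLeft_apply]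
  · refine Integrable.of_bound (C := 1) ?_ (ae_of_all _ fun ω => ?_)
    · exact ((Kernel.measurable_coe κ hB).comp
        (hU.mono hm le_rfl)).ennreal_toReal.aestronglyMeasurable
    · rw [Real.norm_eq_abs, abs_of_nonneg measureReal_nonneg]
      exact measureReal_le_one
  · exact ae_of_all _ fun ω => measureReal_nonneg

variable (hm : m ≤ mΩ) {U : Ω → 𝒳} {V : Ω → ℝ} (hU : Measurable[m] U) (hV : Measurable V)
  (hcond : ∀ B, MeasurableSet B → μ⟦V ⁻¹' B | m⟧ =ᵐ[μ] fun ω => (κ (U ω)).real B)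
  {g : 𝒳 × ℝ → ℝ} (hg : Measurable g) {C : ℝ}
  (hg2 : ∀ x, Integrable (fun y => g (x, y) ^ 2) (κ x))
  (hgC : ∀ x, ∫ y, g (x, y) ^ 2 ∂κ x ≤ C)

include hm hU hV hcond hg hg2 hgC

lemma lintegral_sq_le_of_condExp :
    ∫⁻ ω, ENNReal.ofReal (g (U ω, V ω) ^ 2) ∂μ ≤ ENNReal.ofReal C := by
  have hU' : Measurable U := hU.mono hm le_rfl
  have hmap := map_eq_compProd_of_condExp (W := fun _ : Ω => ()) hm measurable_const hU hV hcond
  have hmeas : Measurable fun q : (Unit × 𝒳) × ℝ => ENNReal.ofReal (g (q.1.2, q.2) ^ 2) := by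
    fun_prop
  have : IsProbabilityMeasure (μ.map fun ω => ((), U ω)) :=
    Measure.isProbabilityMeasure_map (by fun_prop)
  have h1 : ∫⁻ ω, ENNReal.ofReal (g (U ω, V ω) ^ 2) ∂μ =
      ∫⁻ q, ENNReal.ofReal (g (q.1.2, q.2) ^ 2) ∂μ.map (fun ω => (((), U ω), V ω)) := by
    rw [lintegral_map hmeas (by fun_prop)]
  rw [h1, hmap, Measure.lintegral_compProd hmeas]
  calc _ ≤ ∫⁻ _, ENNReal.ofReal C ∂(μ.map fun ω => ((), U ω)) := by
        refine lintegral_mono fun q => ?_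
        rw [Kernel.prodMkLeft_apply, ← ofReal_integral_eq_lintegral_ofReal (hg2 q.2)
          (ae_of_all _ fun y => sq_nonneg _)]
        exact ENNReal.ofReal_le_ofReal (hgC q.2)
    _ = ENNReal.ofReal C := by simp

lemma memLp_two_of_condExp : MemLp (fun ω => g (U ω, V ω)) 2 μ := by
  have hU' : Measurable U := hU.mono hm le_rfl
  have hmeas : Measurable fun ω => g (U ω, V ω) := by fun_prop
  rw [memLp_two_iff_integrable_sq hmeas.aestronglyMeasurable]
  refine ⟨(hmeas.pow_const 2).aestronglyMeasurable, ?_⟩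
  rw [hasFiniteIntegral_iff_ofReal (ae_of_all _ fun ω => sq_nonneg _)]
  exact (lintegral_sq_le_of_condExp hm hU hV hcond hg hg2 hgC).trans_lt ENNReal.ofReal_lt_top

lemma integral_sq_le_of_condExp (hC : 0 ≤ C) : ∫ ω, g (U ω, V ω) ^ 2 ∂μ ≤ C := by
  have hU' : Measurable U := hU.mono hm le_rfl
  have hmeas : Measurable fun ω => g (U ω, V ω) := by fun_prop
  rw [integral_eq_lintegral_of_nonneg_ae (ae_of_all _ fun ω => sq_nonneg _)
    (hmeas.pow_const 2).aestronglyMeasurable]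
  exact ENNReal.toReal_le_of_le_ofReal hC
    (lintegral_sq_le_of_condExp hm hU hV hcond hg hg2 hgC)

/-- If `g` is centred under every `κ x`, then `g (U, V)` is orthogonal to the square integrable
`m`-measurable random variables. -/
lemma integral_mul_eq_zero_of_condExp (hg0 : ∀ x, ∫ y, g (x, y) ∂κ x = 0) {W : Ω → ℝ}
    (hW : Measurable[m] W) (hW2 : MemLp W 2 μ) : ∫ ω, W ω * g (U ω, V ω) ∂μ = 0 := by
  have hU' : Measurable U := hU.mono hm le_rfl
  have hW' : Measurable W := hW.mono hm le_rfl
  have hmap := map_eq_compProd_of_condExp hm hW hU hV hcond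
  have hmeas : Measurable fun q : (ℝ × 𝒳) × ℝ => q.1.1 * g (q.1.2, q.2) := by fun_prop
  have hT : Measurable fun ω => ((W ω, U ω), V ω) := by fun_prop
  have : IsProbabilityMeasure (μ.map fun ω => (W ω, U ω)) :=
    Measure.isProbabilityMeasure_map (by fun_prop)
  have hint : Integrable (fun q : (ℝ × 𝒳) × ℝ => q.1.1 * g (q.1.2, q.2))
      (μ.map fun ω => ((W ω, U ω), V ω)) := by
    rw [integrable_map_measure hmeas.aestronglyMeasurable hT.aemeasurable]
    exact hW2.integrable_mul (memLp_two_of_condExp hm hU hV hcond hg hg2 hgC)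
  have h1 : ∫ ω, W ω * g (U ω, V ω) ∂μ =
      ∫ q, q.1.1 * g (q.1.2, q.2) ∂μ.map (fun ω => ((W ω, U ω), V ω)) := by
    rw [integral_map hT.aemeasurable hmeas.aestronglyMeasurable]
  rw [hmap] at hint
  rw [h1, hmap, Measure.integral_compProd hint]
  simp [integral_const_mul, hg0]

end ConditionalLaw

section Batches

variable {𝒳 Ω : Type*} [MeasurableSpace 𝒳] {mΩ : MeasurableSpace Ω}
  {μ : Measure Ω} [IsProbabilityMeasure μ] {κ : Kernel 𝒳 ℝ} [IsMarkovKernel κ]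

/-- Strong law for responses observed in batches of bounded size: if the responses of batch `k + 1`
have conditional distributions `κ (X i ·)` given `ℱ k`, and `g` is centred and has bounded second
moments under `κ`, then the sum of `g (X i, Y i)` over the first `k` batches is `o(k)`. The batch
sums are orthogonal, since each of them is conditionally centred given the past. -/
theorem ae_tendsto_sum_batches {n : ℕ → ℕ} (hn0 : n 0 = 0) (hn : Monotone n) {N : ℕ}
    (hnN : ∀ k, n (k + 1) - n k ≤ N) {ℱ : Filtration ℕ mΩ} {X : ℕ → Ω → 𝒳} {Y : ℕ → Ω → ℝ}
    (hXY : ∀ k, ∀ i ∈ Finset.Ico (n k) (n (k + 1)),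
      Measurable[ℱ k] (X i) ∧ Measurable[ℱ (k + 1)] (Y i))
    (hcond : ∀ k, ∀ i ∈ Finset.Ico (n k) (n (k + 1)), ∀ B, MeasurableSet B →
      μ⟦Y i ⁻¹' B | ℱ k⟧ =ᵐ[μ] fun ω => (κ (X i ω)).real B)
    {g : 𝒳 × ℝ → ℝ} (hg : Measurable g) {C : ℝ} (hC : 0 ≤ C)
    (hg2 : ∀ x, Integrable (fun y => g (x, y) ^ 2) (κ x))
    (hgC : ∀ x, ∫ y, g (x, y) ^ 2 ∂κ x ≤ C) (hg0 : ∀ x, ∫ y, g (x, y) ∂κ x = 0) :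
    ∀ᵐ ω ∂μ, Tendsto (fun k : ℕ => (∑ i ∈ Finset.range (n k), g (X i ω, Y i ω)) / k)
      atTop (𝓝 0) := by
  let Z : ℕ → Ω → ℝ := fun k ω => ∑ i ∈ Finset.Ico (n k) (n (k + 1)), g (X i ω, Y i ω)
  have hYm : ∀ k, ∀ i ∈ Finset.Ico (n k) (n (k + 1)), Measurable (Y i) := fun k i hi =>
    (hXY k i hi).2.mono (ℱ.le _) le_rfl
  have hL : ∀ k, ∀ i ∈ Finset.Ico (n k) (n (k + 1)), MemLp (fun ω => g (X i ω, Y i ω)) 2 μ :=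
    fun k i hi => memLp_two_of_condExp (ℱ.le k) (hXY k i hi).1 (hYm k i hi) (hcond k i hi)
      hg hg2 hgC
  have hZ : ∀ k, MemLp (Z k) 2 μ := fun k => memLp_finsetSum _ fun i hi => hL k i hi
  have hZm : ∀ k, Measurable[ℱ (k + 1)] (Z k) := fun k =>
    Finset.measurable_fun_sum _ fun i hi => hg.comp
      (((hXY k i hi).1.mono (ℱ.mono k.le_succ) le_rfl).prodMk (hXY k i hi).2)
  have horth : ∀ j k, j < k → ∫ ω, Z j ω * Z k ω ∂μ = 0 := fun j k hjk => by
    change ∫ ω, Z j ω * ∑ i ∈ Finset.Ico (n k) (n (k + 1)), g (X i ω, Y i ω) ∂μ = 0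
    simp only [Finset.mul_sum]
    rw [integral_finsetSum _ fun i hi => show Integrable (fun ω => Z j ω * g (X i ω, Y i ω)) μ from
      (hZ j).integrable_mul (hL k i hi)]
    exact Finset.sum_eq_zero fun i hi => integral_mul_eq_zero_of_condExp (ℱ.le k) (hXY k i hi).1
      (hYm k i hi) (hcond k i hi) hg hg2 hgC hg0 ((hZm j).mono (ℱ.mono hjk) le_rfl) (hZ j)
  have hbound : ∀ k, ∫ ω, Z k ω ^ 2 ∂μ ≤ N * (N * C) := fun k => by
    have hcard : ((Finset.Ico (n k) (n (k + 1))).card : ℝ) ≤ N := by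
      rw [Nat.card_Ico]
      exact_mod_cast hnN k
    have hint := integrable_finsetSum (Finset.Ico (n k) (n (k + 1)))
      fun i hi => (hL k i hi).integrable_sq
    calc ∫ ω, Z k ω ^ 2 ∂μ
        ≤ ∫ ω, N * ∑ i ∈ Finset.Ico (n k) (n (k + 1)), g (X i ω, Y i ω) ^ 2 ∂μ := by
          refine integral_mono (hZ k).integrable_sq (hint.const_mul _) fun ω => ?_
          refine (sq_sum_le_card_mul_sum_sq (s := Finset.Ico (n k) (n (k + 1)))
            (f := fun i => g (X i ω, Y i ω))).trans ?_
          exact mul_le_mul_of_nonneg_right hcard (Finset.sum_nonneg fun i _ => sq_nonneg _)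
      _ = N * ∑ i ∈ Finset.Ico (n k) (n (k + 1)), ∫ ω, g (X i ω, Y i ω) ^ 2 ∂μ := by
          rw [integral_const_mul, integral_finsetSum _ fun i hi => (hL k i hi).integrable_sq]
      _ ≤ N * ((Finset.Ico (n k) (n (k + 1))).card * C) := by
          gcongr
          rw [← nsmul_eq_mul]
          exact Finset.sum_le_card_nsmul _ _ _ fun i hi => integral_sq_le_of_condExp (ℱ.le k)
            (hXY k i hi).1 (hYm k i hi) (hcond k i hi) hg hg2 hgC hC
      _ ≤ N * (N * C) := by gcongr
  have hsum : ∀ k ω, ∑ j ∈ Finset.range k, Z j ω =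
      ∑ i ∈ Finset.range (n k), g (X i ω, Y i ω) := fun k ω => by
    induction k with
    | zero => simp [hn0]
    | succ k ih =>
      rw [Finset.sum_range_succ, ih]
      exact Finset.sum_range_add_sum_Ico _ (hn k.le_succ)
  filter_upwards [ae_tendsto_average_of_orthogonal hZ horth hbound] with ω hω
  simpa only [hsum] using hω

end Batches

/-! ### The response kernel of the exponential family -/

namespace ExpFamily

variable {E : ExpFamily}

lemma sFinite_baseMeasure {τ : ℝ} (hτ : τ ∈ E.J) : SFinite E.baseMeasure := by
  have : IsProbabilityMeasure (E.P τ) := E.isProbabilityMeasure τ hτ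
  have hmeas : Measurable fun y : ℝ => ENNReal.ofReal (Real.exp (τ * y - E.b τ)) := by fun_prop
  -- `ν` need not be s-finite, but the base measure has a density with respect to `P_τ`.
  rw [← withDensity_inv_same (μ := E.baseMeasure) hmeas
    (ae_of_all _ fun y => (ENNReal.ofReal_pos.2 (Real.exp_pos _)).ne')
    (ae_of_all _ fun y => ENNReal.ofReal_ne_top), ← P_eq_withDensity]
  infer_instance

variable {𝒳 : Type*} [TopologicalSpace 𝒳] [MeasurableSpace 𝒳] [BorelSpace 𝒳] {t : 𝒳 → ℝ}

lemma measurable_P_comp (ht : Continuous t) (htJ : ∀ x, t x ∈ E.J) :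
    Measurable fun x => E.P (t x) := by
  rcases isEmpty_or_nonempty 𝒳 with h | ⟨⟨x₀⟩⟩
  · exact measurable_of_empty _
  have := sFinite_baseMeasure (htJ x₀)
  have hb : Measurable fun x => E.b (t x) :=
    (continuousOn_b.comp_continuous ht htJ).measurable
  have ht' := ht.measurable
  refine Measure.measurable_of_measurable_coe _ fun B hB => ?_
  simp_rw [P_eq_withDensity, withDensity_apply _ hB]
  refine Measurable.lintegral_prod_right' (ν := E.baseMeasure.restrict B)
    (f := fun q : 𝒳 × ℝ => ENNReal.ofReal (Real.exp (t q.1 * q.2 - E.b (t q.1)))) ?_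
  exact (((ht'.comp measurable_fst).mul measurable_snd).sub
    (hb.comp measurable_fst)).exp.ennreal_ofReal

/-- The kernel `x ↦ P_{t(x)}` for a continuous choice `t` of canonical parameters. -/
noncomputable def kernel (E : ExpFamily) (t : 𝒳 → ℝ) (ht : Continuous t)
    (htJ : ∀ x, t x ∈ E.J) : Kernel 𝒳 ℝ :=
  ⟨fun x => E.P (t x), measurable_P_comp ht htJ⟩

lemma kernel_apply (ht : Continuous t) (htJ : ∀ x, t x ∈ E.J) (x : 𝒳) :
    E.kernel t ht htJ x = E.P (t x) := rfl

lemma isMarkovKernel_kernel (ht : Continuous t) (htJ : ∀ x, t x ∈ E.J) :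
    IsMarkovKernel (E.kernel t ht htJ) :=
  ⟨fun x => E.isProbabilityMeasure _ (htJ x)⟩

end ExpFamily

/-! ### Strong laws for the errors -/

namespace ExpFamily

variable {E : ExpFamily} {τ : ℝ}

lemma memLp_sub_P (hτ : τ ∈ E.J) : MemLp (fun y : ℝ => y - deriv E.b τ) 2 (E.P τ) := by
  have : IsProbabilityMeasure (E.P τ) := E.isProbabilityMeasure τ hτ
  exact (memLp_P hτ).sub (memLp_const _)

lemma integral_sub_P (hτ : τ ∈ E.J) : ∫ y, (y - deriv E.b τ) ∂E.P τ = 0 := by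
  have : IsProbabilityMeasure (E.P τ) := E.isProbabilityMeasure τ hτ
  rw [integral_sub ((memLp_P hτ).integrable one_le_two) (integrable_const _), integral_P hτ]
  simp

lemma integral_sub_sq_P (hτ : τ ∈ E.J) :
    ∫ y, (y - deriv E.b τ) ^ 2 ∂E.P τ = deriv (deriv E.b) τ := by
  rw [← variance_P hτ, variance_eq_integral measurable_id'.aemeasurable, integral_P hτ]

/-- The mean absolute deviation of `P_τ` from its mean `b'(τ)`. -/
noncomputable def meanAbsDev (E : ExpFamily) (τ : ℝ) : ℝ := ∫ y, |y - deriv E.b τ| ∂E.P τ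

lemma meanAbsDev_le (hτ : τ ∈ E.J) : E.meanAbsDev τ ≤ 1 + deriv (deriv E.b) τ := by
  have : IsProbabilityMeasure (E.P τ) := E.isProbabilityMeasure τ hτ
  have h2 := (memLp_sub_P hτ).integrable_sq
  calc E.meanAbsDev τ ≤ ∫ y, (1 + (y - deriv E.b τ) ^ 2) ∂E.P τ := by
        refine integral_mono ((memLp_sub_P hτ).integrable one_le_two).abs
          ((integrable_const 1).add h2) fun y => ?_
        dsimp only
        rw [← sq_abs (y - deriv E.b τ)]
        nlinarith [sq_nonneg (|y - deriv E.b τ| - 1), abs_nonneg (y - deriv E.b τ)]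
    _ = 1 + deriv (deriv E.b) τ := by
        rw [integral_add (integrable_const 1) h2, integral_sub_sq_P hτ]
        simp

lemma memLp_abs_sub_P (hτ : τ ∈ E.J) :
    MemLp (fun y : ℝ => |y - deriv E.b τ| - E.meanAbsDev τ) 2 (E.P τ) := by
  have : IsProbabilityMeasure (E.P τ) := E.isProbabilityMeasure τ hτ
  exact (memLp_sub_P hτ).abs.sub (memLp_const _)

lemma integral_abs_sub_P (hτ : τ ∈ E.J) :
    ∫ y, (|y - deriv E.b τ| - E.meanAbsDev τ) ∂E.P τ = 0 := by
  have : IsProbabilityMeasure (E.P τ) := E.isProbabilityMeasure τ hτ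
  rw [integral_sub ((memLp_sub_P hτ).integrable one_le_two).abs (integrable_const _)]
  simp [meanAbsDev]

lemma integral_abs_sub_sq_le_P (hτ : τ ∈ E.J) :
    ∫ y, (|y - deriv E.b τ| - E.meanAbsDev τ) ^ 2 ∂E.P τ ≤ deriv (deriv E.b) τ := by
  have : IsProbabilityMeasure (E.P τ) := E.isProbabilityMeasure τ hτ
  have h := variance_le_expectation_sq (μ := E.P τ) (X := fun y => |y - deriv E.b τ|)
    (memLp_sub_P hτ).abs.aestronglyMeasurable
  rw [variance_eq_integral (X := fun y => |y - deriv E.b τ|)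
    (memLp_sub_P hτ).abs.aestronglyMeasurable.aemeasurable] at h
  simp only [Pi.pow_apply, sq_abs] at h
  rwa [integral_sub_sq_P hτ] at h

section Noise

variable {𝒳 Ω : Type*} [MetricSpace 𝒳] [CompactSpace 𝒳] [MeasurableSpace 𝒳] [BorelSpace 𝒳]
  {mΩ : MeasurableSpace Ω} {μ : Measure Ω} [IsProbabilityMeasure μ]

omit [MeasurableSpace 𝒳] [BorelSpace 𝒳] in
lemma exists_deriv_deriv_b_le {t : 𝒳 → ℝ} (ht : Continuous t) (htJ : ∀ x, t x ∈ E.J) :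
    ∃ C, 0 ≤ C ∧ ∀ x, deriv (deriv E.b) (t x) ≤ C := by
  obtain ⟨C, hC⟩ := (isCompact_range
    (continuousOn_deriv_deriv_b.comp_continuous ht htJ)).bddAbove
  exact ⟨max C 0, le_max_right _ _, fun x => (hC ⟨x, rfl⟩).trans (le_max_left _ _)⟩

omit [CompactSpace 𝒳] in
lemma measurable_meanAbsDev_comp {t : 𝒳 → ℝ} (ht : Continuous t) (htJ : ∀ x, t x ∈ E.J) :
    Measurable fun x => E.meanAbsDev (t x) := by
  have := isMarkovKernel_kernel ht htJ
  have hd : Measurable fun x => deriv E.b (t x) :=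
    (continuousOn_deriv_b.comp_continuous ht htJ).measurable
  have hmeas : Measurable fun q : 𝒳 × ℝ => |q.2 - deriv E.b (t q.1)| :=
    (measurable_snd.sub (hd.comp measurable_fst)).abs
  exact (hmeas.stronglyMeasurable.integral_kernel_prod_right' (κ := E.kernel t ht htJ)).measurable

variable {t : 𝒳 → ℝ} (ht : Continuous t) (htJ : ∀ x, t x ∈ E.J)
  {n : ℕ → ℕ} (hn0 : n 0 = 0) (hn : Monotone n) {N : ℕ}
  (hnN : ∀ k, n (k + 1) - n k ≤ N) {ℱ : Filtration ℕ mΩ} {X : ℕ → Ω → 𝒳} {Y : ℕ → Ω → ℝ}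
  (hXY : ∀ k, ∀ i ∈ Finset.Ico (n k) (n (k + 1)),
    Measurable[ℱ k] (X i) ∧ Measurable[ℱ (k + 1)] (Y i))
  (hcond : ∀ k, ∀ i ∈ Finset.Ico (n k) (n (k + 1)), ∀ B, MeasurableSet B →
    μ⟦Y i ⁻¹' B | ℱ k⟧ =ᵐ[μ] fun ω => (E.kernel t ht htJ (X i ω)).real B)

include ht htJ hn0 hn hnN hXY hcond

/-- The errors with continuous weights at the design points satisfy the strong law. -/
lemma ae_tendsto_sum_mul_error {h : 𝒳 → ℝ} (hh : Continuous h) :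
    ∀ᵐ ω ∂μ, Tendsto (fun k : ℕ =>
      (∑ i ∈ Finset.range (n k), h (X i ω) * (Y i ω - deriv E.b (t (X i ω)))) / k)
      atTop (𝓝 0) := by
  have := isMarkovKernel_kernel ht htJ
  obtain ⟨C, hC0, hC⟩ := exists_deriv_deriv_b_le ht htJ
  obtain ⟨H, hH⟩ := (isCompact_range (hh.pow 2)).bddAbove
  have hH' : ∀ x, h x ^ 2 ≤ max H 0 := fun x => (hH ⟨x, rfl⟩).trans (le_max_left _ _)
  have hd : Measurable fun x => deriv E.b (t x) :=
    (continuousOn_deriv_b.comp_continuous ht htJ).measurable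
  have hmeas : Measurable fun q : 𝒳 × ℝ => h q.1 * (q.2 - deriv E.b (t q.1)) :=
    (hh.measurable.comp measurable_fst).mul (measurable_snd.sub (hd.comp measurable_fst))
  have hC' : 0 ≤ max H 0 * C := mul_nonneg (le_max_right _ _) hC0
  refine ae_tendsto_sum_batches (g := fun q => h q.1 * (q.2 - deriv E.b (t q.1))) hn0 hn hnN
    hXY hcond hmeas hC' (fun x => ?_) (fun x => ?_) fun x => ?_
  · simp only [mul_pow]
    exact (memLp_sub_P (htJ x)).integrable_sq.const_mul _
  · simp only [mul_pow]
    rw [integral_const_mul, kernel_apply, integral_sub_sq_P (htJ x)]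
    exact mul_le_mul (hH' x) (hC x) (deriv_deriv_b_pos (htJ x)).le (le_max_right _ _)
  · simp only []
    rw [integral_const_mul, kernel_apply, integral_sub_P (htJ x), mul_zero]

/-- The sum of the absolute errors is at most linear in the number of batches, almost surely: the
strong law applies to the absolute errors after subtraction of their conditional means, which are
bounded. -/
lemma exists_ae_eventually_sum_abs_error_le :
    ∃ A : ℝ, 0 < A ∧ ∀ᵐ ω ∂μ, ∀ᶠ k : ℕ in atTop,
      ∑ i ∈ Finset.range (n k), |Y i ω - deriv E.b (t (X i ω))| ≤ A * k := by
  have := isMarkovKernel_kernel ht htJ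
  obtain ⟨C, hC0, hC⟩ := exists_deriv_deriv_b_le ht htJ
  have hd : Measurable fun x => deriv E.b (t x) :=
    (continuousOn_deriv_b.comp_continuous ht htJ).measurable
  have hmeas : Measurable fun q : 𝒳 × ℝ => |q.2 - deriv E.b (t q.1)| - E.meanAbsDev (t q.1) :=
    (measurable_snd.sub (hd.comp measurable_fst)).abs.sub
      ((measurable_meanAbsDev_comp ht htJ).comp measurable_fst)
  have hlim := ae_tendsto_sum_batches
    (g := fun q => |q.2 - deriv E.b (t q.1)| - E.meanAbsDev (t q.1)) hn0 hn hnN hXY hcond hmeas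
    hC0 (fun x => (memLp_abs_sub_P (htJ x)).integrable_sq)
    (fun x => (integral_abs_sub_sq_le_P (htJ x)).trans (hC x))
    (fun x => integral_abs_sub_P (htJ x))
  have hnk : ∀ k, n k ≤ k * N := fun k => by
    induction k with
    | zero => simp [hn0]
    | succ k ih =>
      have := hnN k
      rw [Nat.succ_mul]
      omega
  refine ⟨N * (1 + C) + 1, by positivity, ?_⟩
  filter_upwards [hlim] with ω hω
  filter_upwards [hω.eventually (gt_mem_nhds one_pos), eventually_gt_atTop 0] with k hk hk0
  rw [div_lt_one (by exact_mod_cast hk0), Finset.sum_sub_distrib] at hk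
  have h1 : ∑ i ∈ Finset.range (n k), E.meanAbsDev (t (X i ω)) ≤ n k * (1 + C) := by
    have := Finset.sum_le_card_nsmul (Finset.range (n k)) (fun i => E.meanAbsDev (t (X i ω)))
      (1 + C) fun i _ => (meanAbsDev_le (htJ _)).trans (by linarith [hC (X i ω)])
    simpa only [Finset.card_range, nsmul_eq_mul] using this
  have h2 : (n k : ℝ) * (1 + C) ≤ k * N * (1 + C) := by
    gcongr
    exact_mod_cast hnk k
  nlinarith

/-- The strong law for the weighted errors is uniform over a compact set of parameters of the
weights: the weights can be replaced by those at the points of a finite net, at the expense of a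
small multiple of the sum of the absolute errors. -/
theorem ae_eventually_forall_sum_mul_error_le {P : Type*} [PseudoMetricSpace P] {Θ : Set P}
    (hΘ : IsCompact Θ) {h : 𝒳 → P → ℝ}
    (hh : ContinuousOn (fun q : 𝒳 × P => h q.1 q.2) (Set.univ ×ˢ Θ)) :
    ∀ᵐ ω ∂μ, ∀ ε > 0, ∀ᶠ k : ℕ in atTop, ∀ θ ∈ Θ,
      |∑ i ∈ Finset.range (n k), h (X i ω) θ * (Y i ω - deriv E.b (t (X i ω)))| ≤ ε * k := by
  have hnet : ∀ m : ℕ, ∃ s ⊆ Θ, s.Finite ∧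
      ∀ θ ∈ Θ, ∃ θ' ∈ s, ∀ x, |h x θ - h x θ'| ≤ 1 / ((m : ℝ) + 1) := by
    intro m
    have huc := (isCompact_univ.prod hΘ).uniformContinuousOn_of_continuous hh
    obtain ⟨δ, hδ, hδ'⟩ := Metric.uniformContinuousOn_iff.1 huc (1 / ((m : ℝ) + 1))
      (by positivity)
    obtain ⟨s, hs, hsf, hcov⟩ := hΘ.finite_cover_balls hδ
    refine ⟨s, hs, hsf, fun θ hθ => ?_⟩
    obtain ⟨θ', hθ', hθθ'⟩ := Set.mem_iUnion₂.1 (hcov hθ)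
    refine ⟨θ', hθ', fun x => ?_⟩
    have := hδ' (x, θ) ⟨trivial, hθ⟩ (x, θ') ⟨trivial, hs hθ'⟩
      (by simpa [Prod.dist_eq, hδ] using hθθ')
    exact this.le
  -- One net for each accuracy `1 / (m + 1)`: only countably many weights enter, so that the strong
  -- law holds for all of them outside a common null set.
  choose s hsΘ hsf hs using hnet
  obtain ⟨A, hA0, hA⟩ := exists_ae_eventually_sum_abs_error_le ht htJ hn0 hn hnN hXY hcond
  have hpt : ∀ᵐ ω ∂μ, ∀ m, ∀ θ ∈ s m, Tendsto (fun k : ℕ =>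
      (∑ i ∈ Finset.range (n k), h (X i ω) θ * (Y i ω - deriv E.b (t (X i ω)))) / k)
      atTop (𝓝 0) := by
    refine ae_all_iff.2 fun m => (ae_ball_iff (hsf m).countable).2 fun θ hθ => ?_
    refine ae_tendsto_sum_mul_error (h := fun x => h x θ) ht htJ hn0 hn hnN hXY hcond ?_
    exact hh.comp_continuous (f := fun x : 𝒳 => (x, θ)) (by fun_prop)
      fun x => ⟨trivial, hsΘ m hθ⟩
  filter_upwards [hA, hpt] with ω hAω hω ε hε
  obtain ⟨m, hm⟩ := exists_nat_one_div_lt (show 0 < ε / (2 * A) by positivity)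
  have hfin : ∀ᶠ k : ℕ in atTop, ∀ θ ∈ s m,
      |(∑ i ∈ Finset.range (n k), h (X i ω) θ * (Y i ω - deriv E.b (t (X i ω)))) / k| < ε / 2 := by
    refine (Filter.eventually_all_finite (hsf m)).2 fun θ hθ => ?_
    have := (hω m θ hθ).abs
    rw [abs_zero] at this
    exact this.eventually (gt_mem_nhds (by positivity))
  filter_upwards [hAω, hfin, eventually_gt_atTop 0] with k hk hfk hk0 θ hθ
  have hk0' : (0 : ℝ) < k := by exact_mod_cast hk0
  obtain ⟨θ', hθ', hθθ'⟩ := hs m θ hθ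
  have h1 := hfk θ' hθ'
  rw [abs_div, Nat.abs_cast, div_lt_iff₀ hk0'] at h1
  have h2 : |∑ i ∈ Finset.range (n k),
      (h (X i ω) θ - h (X i ω) θ') * (Y i ω - deriv E.b (t (X i ω)))| ≤ ε / 2 * k := by
    calc _ ≤ ∑ i ∈ Finset.range (n k),
          ε / (2 * A) * |Y i ω - deriv E.b (t (X i ω))| := by
          refine (Finset.abs_sum_le_sum_abs _ _).trans (Finset.sum_le_sum fun i _ => ?_)
          rw [abs_mul]
          exact mul_le_mul_of_nonneg_right ((hθθ' _).trans hm.le) (abs_nonneg _)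
      _ ≤ ε / (2 * A) * (A * k) := by
          rw [← Finset.mul_sum]
          gcongr
      _ = ε / 2 * k := by field_simp
  have h3 : ∑ i ∈ Finset.range (n k), h (X i ω) θ * (Y i ω - deriv E.b (t (X i ω))) =
      ∑ i ∈ Finset.range (n k),
        (h (X i ω) θ - h (X i ω) θ') * (Y i ω - deriv E.b (t (X i ω))) +
      ∑ i ∈ Finset.range (n k), h (X i ω) θ' * (Y i ω - deriv E.b (t (X i ω))) := by
    rw [← Finset.sum_add_distrib]
    exact Finset.sum_congr rfl fun i _ => by ring
  rw [h3]
  refine (abs_add_le _ _).trans ?_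
  linarith

end Noise

end ExpFamily

/-! ### The design of the `p`-step-ahead algorithm -/

/-- The matrix with columns `f(z_1), …, f(z_p)`. -/
def designMatrix {𝒳 : Type*} {p : ℕ} (f : 𝒳 → EuclideanSpace ℝ (Fin p)) (z : Fin p → 𝒳) :
    Matrix (Fin p) (Fin p) ℝ :=
  Matrix.of fun i j => f (z j) i

section Design

variable {𝒳 : Type*} {p : ℕ} {f : 𝒳 → EuclideanSpace ℝ (Fin p)}

lemma continuous_designMatrix [TopologicalSpace 𝒳] (hf : Continuous f) :
    Continuous (designMatrix f) := by
  refine continuous_matrix fun i j => ?_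
  simp only [designMatrix, Matrix.of_apply]
  fun_prop

lemma exists_det_designMatrix_ne_zero (hspan : Submodule.span ℝ (Set.range f) = ⊤) :
    ∃ z, (designMatrix f z).det ≠ 0 := by
  let e := (EuclideanSpace.basisFun (Fin p) ℝ).toBasis
  let b := (Module.Basis.ofSpan hspan.ge).reindex ((Module.Basis.ofSpan hspan.ge).indexEquiv e)
  have hb : ∀ j, b j ∈ Set.range f := fun j => by
    apply Module.Basis.ofSpan_subset hspan.ge
    simp only [b, Module.Basis.reindex_apply]
    exact ⟨_, rfl⟩
  choose z hz using hb
  refine ⟨z, ?_⟩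
  have hdet : e.det b = (designMatrix f z).det := by
    rw [Module.Basis.det_apply]
    congr 1
    ext i j
    simp [Module.Basis.toMatrix_apply, designMatrix, hz, e]
  rw [← hdet]
  exact (e.isUnit_det b).ne_zero

/-- A nonsingular design determines the parameter from the linear predictors. -/
lemma eq_of_inner_eq_of_det_ne_zero {z : Fin p → 𝒳} (hz : (designMatrix f z).det ≠ 0)
    {θ θ' : EuclideanSpace ℝ (Fin p)} (h : ∀ j, inner ℝ (f (z j)) θ = inner ℝ (f (z j)) θ') :
    θ = θ' := by
  have hmul : Matrix.vecMul (θ - θ').ofLp (designMatrix f z) = 0 := by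
    ext j
    have := h j
    rw [← sub_eq_zero, ← inner_sub_right, PiLp.inner_apply] at this
    simpa [Matrix.vecMul, dotProduct, designMatrix] using this
  have := Matrix.eq_zero_of_vecMul_eq_zero hz hmul
  exact sub_eq_zero.1 (WithLp.ofLp_injective 2 this)

variable [TopologicalSpace 𝒳] {M : RegressionModel 𝒳 p}
  {ψ : 𝒳 → EuclideanSpace ℝ (Fin p) → ℝ}

lemma RegressionModel.GLM.det_regMatrix (h : M.GLM ψ f) {θ : EuclideanSpace ℝ (Fin p)}
    (hθ : θ ∈ M.Θ) (z : Fin p → 𝒳) :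
    (M.regMatrix θ z).det = (∏ j, ψ (z j) θ) * (designMatrix f z).det := by
  rw [← Matrix.det_mul_row]
  congr 1
  ext i j
  simp [regMatrix, designMatrix, h.reg_eq _ θ hθ]

/-- Under (GLM) the D-optimal batches have determinants bounded away from zero, whatever the
parameter at which the optimality criterion is evaluated. -/
lemma RegressionModel.GLM.exists_le_det_sq [CompactSpace 𝒳] [Nonempty 𝒳] (h : M.GLM ψ f)
    (hM : M.Basic) (hne : M.Θ.Nonempty) :
    ∃ d > 0, ∀ θ ∈ M.Θ, ∀ z,
      (∀ z', (M.regMatrix θ z').det ^ 2 ≤ (M.regMatrix θ z).det ^ 2) →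
        d ≤ (designMatrix f z).det ^ 2 := by
  obtain ⟨θ₀, hθ₀⟩ := hne
  have hspan : Submodule.span ℝ (Set.range f) = ⊤ := by
    rw [← top_le_iff, ← hM.span_reg θ₀ hθ₀, Submodule.span_le]
    rintro _ ⟨x, rfl⟩
    rw [h.reg_eq x θ₀ hθ₀]
    exact Submodule.smul_mem _ _ (Submodule.subset_span ⟨x, rfl⟩)
  obtain ⟨z₀, hz₀⟩ := exists_det_designMatrix_ne_zero hspan
  have hK : IsCompact ((Set.univ : Set 𝒳) ×ˢ M.Θ) := isCompact_univ.prod hM.isCompact_Θ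
  have hKne : ((Set.univ : Set 𝒳) ×ˢ M.Θ).Nonempty :=
    Set.univ_nonempty.prod ⟨θ₀, hθ₀⟩
  obtain ⟨q₁, hq₁, hmin⟩ := hK.exists_isMinOn hKne h.continuousOn_ψ
  obtain ⟨q₂, hq₂, hmax⟩ := hK.exists_isMaxOn hKne h.continuousOn_ψ
  have ha : 0 < ψ q₁.1 q₁.2 := h.ψ_pos _ _ hq₁.2
  have hA : 0 < ψ q₂.1 q₂.2 := h.ψ_pos _ _ hq₂.2
  refine ⟨((ψ q₁.1 q₁.2) ^ p * (designMatrix f z₀).det) ^ 2 / ((ψ q₂.1 q₂.2) ^ p) ^ 2,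
    by positivity, fun θ hθ z hz => ?_⟩
  have hlow : (ψ q₁.1 q₁.2) ^ p ≤ ∏ j, ψ (z₀ j) θ := by
    have := Finset.prod_le_prod (s := (Finset.univ : Finset (Fin p)))
      (f := fun _ => ψ q₁.1 q₁.2) (g := fun j => ψ (z₀ j) θ) (fun _ _ => ha.le)
      fun j _ => hmin (show (z₀ j, θ) ∈ _ from ⟨trivial, hθ⟩)
    simpa using this
  have hup : ∏ j, ψ (z j) θ ≤ (ψ q₂.1 q₂.2) ^ p := by
    have := Finset.prod_le_prod (s := (Finset.univ : Finset (Fin p)))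
      (f := fun j => ψ (z j) θ) (g := fun _ => ψ q₂.1 q₂.2) (fun j _ => (h.ψ_pos _ θ hθ).le)
      fun j _ => hmax (show (z j, θ) ∈ _ from ⟨trivial, hθ⟩)
    simpa using this
  have hpos : 0 < ∏ j, ψ (z j) θ := Finset.prod_pos fun j _ => h.ψ_pos _ θ hθ
  have h1 := hz z₀
  rw [h.det_regMatrix hθ, h.det_regMatrix hθ] at h1
  rw [div_le_iff₀ (by positivity)]
  calc _ ≤ ((∏ j, ψ (z₀ j) θ) * (designMatrix f z₀).det) ^ 2 := by
        rw [mul_pow, mul_pow]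
        gcongr
    _ ≤ ((∏ j, ψ (z j) θ) * (designMatrix f z).det) ^ 2 := h1
    _ ≤ _ := by
        rw [mul_pow, mul_comm]
        gcongr

end Design

/-! ### The canonical parameter and the divergences of a batch -/

namespace RegressionModel.GLMStar

variable {𝒳 : Type*} [TopologicalSpace 𝒳] {p : ℕ} {M : RegressionModel 𝒳 p} {E : ExpFamily}
  {ψ : 𝒳 → EuclideanSpace ℝ (Fin p) → ℝ} {f : 𝒳 → EuclideanSpace ℝ (Fin p)}
  {I : Set ℝ} {G : ℝ → ℝ} (h : M.GLMStar ψ f I G) (hGI : Set.MapsTo G I (deriv E.b '' E.J))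

include h

lemma injOn_G : Set.InjOn G I := by
  refine (strictMonoOn_of_deriv_pos h.ordConnected_I.convex h.contDiffOn_G.continuousOn
    fun u hu => h.deriv_G_pos u (interior_subset hu)).injOn

include hGI

lemma canonicalParam_mem {x : 𝒳} {θ : EuclideanSpace ℝ (Fin p)} (hθ : θ ∈ M.Θ) :
    E.canonicalParam G f x θ ∈ E.J :=
  ExpFamily.derivInv_mem (hGI (h.mem_I x θ hθ))

lemma continuousOn_canonicalParam :
    ContinuousOn (fun q : 𝒳 × EuclideanSpace ℝ (Fin p) => E.canonicalParam G f q.1 q.2)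
      (Set.univ ×ˢ M.Θ) := by
  have hf := h.continuous_f
  have h1 : ContinuousOn (fun q : 𝒳 × EuclideanSpace ℝ (Fin p) => (inner ℝ (f q.1) q.2 : ℝ))
      (Set.univ ×ˢ M.Θ) := by fun_prop
  have h2 := h.contDiffOn_G.continuousOn.comp h1 fun q hq => h.mem_I q.1 q.2 hq.2
  exact ExpFamily.continuousOn_derivInv.comp h2 fun q hq => hGI (h.mem_I q.1 q.2 hq.2)

lemma continuous_canonicalParam {θ : EuclideanSpace ℝ (Fin p)} (hθ : θ ∈ M.Θ) :
    Continuous fun x => E.canonicalParam G f x θ :=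
  (h.continuousOn_canonicalParam hGI).comp_continuous (f := fun x : 𝒳 => (x, θ)) (by fun_prop)
    fun _ => ⟨trivial, hθ⟩

lemma inner_eq_of_canonicalParam_eq {x : 𝒳} {θ θ' : EuclideanSpace ℝ (Fin p)} (hθ : θ ∈ M.Θ)
    (hθ' : θ' ∈ M.Θ) (heq : E.canonicalParam G f x θ = E.canonicalParam G f x θ') :
    inner ℝ (f x) θ = (inner ℝ (f x) θ' : ℝ) :=
  h.injOn_G (h.mem_I x θ hθ) (h.mem_I x θ' hθ')
    (ExpFamily.injOn_derivInv (hGI (h.mem_I x θ hθ)) (hGI (h.mem_I x θ' hθ')) heq)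

/-- The divergences of the batches with determinant bounded away from zero separate the true
parameter from the parameters at distance at least `ε`, uniformly in the batch. -/
lemma exists_le_sum_klDiv [CompactSpace 𝒳] (hM : M.Basic) {θbar : EuclideanSpace ℝ (Fin p)}
    (hθbar : θbar ∈ M.Θ) {d ε : ℝ} (hd : 0 < d) (hε : 0 < ε) :
    ∃ η > 0, ∀ z : Fin p → 𝒳, d ≤ (designMatrix f z).det ^ 2 → ∀ θ ∈ M.Θ, ε ≤ dist θ θbar →
      η ≤ ∑ j, E.klDiv (E.canonicalParam G f (z j) θbar) (E.canonicalParam G f (z j) θ) := by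
  let S : Set ((Fin p → 𝒳) × EuclideanSpace ℝ (Fin p)) :=
    (Set.univ ×ˢ M.Θ) ∩ {q | d ≤ (designMatrix f q.1).det ^ 2 ∧ ε ≤ dist q.2 θbar}
  have hdet : Continuous fun q : (Fin p → 𝒳) × EuclideanSpace ℝ (Fin p) =>
      (designMatrix f q.1).det ^ 2 :=
    (((continuous_designMatrix h.continuous_f).comp continuous_fst).matrix_det).pow 2
  have hS : IsCompact S := by
    refine (isCompact_univ.prod hM.isCompact_Θ).inter_right ?_
    exact (isClosed_le continuous_const hdet).inter
      (isClosed_le continuous_const (continuous_snd.dist continuous_const))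
  have hbar := h.continuous_canonicalParam hGI hθbar
  have hcont : ContinuousOn (fun q : (Fin p → 𝒳) × EuclideanSpace ℝ (Fin p) =>
      ∑ j, E.klDiv (E.canonicalParam G f (q.1 j) θbar) (E.canonicalParam G f (q.1 j) q.2)) S := by
    refine continuousOn_finsetSum _ fun j _ => ?_
    have h1 : ContinuousOn (fun q : (Fin p → 𝒳) × EuclideanSpace ℝ (Fin p) =>
        E.canonicalParam G f (q.1 j) q.2) S :=
      (h.continuousOn_canonicalParam hGI).comp
        (f := fun q : (Fin p → 𝒳) × EuclideanSpace ℝ (Fin p) => (q.1 j, q.2))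
        (by fun_prop) fun q hq => ⟨trivial, hq.1.2⟩
    have h2 : Continuous (fun q : (Fin p → 𝒳) × EuclideanSpace ℝ (Fin p) =>
        E.canonicalParam G f (q.1 j) θbar) :=
      hbar.comp ((continuous_apply j).comp continuous_fst)
    have hb1 := ExpFamily.continuousOn_b.comp h1 fun q hq => h.canonicalParam_mem hGI hq.1.2
    have hb2 := ExpFamily.continuousOn_b.comp_continuous h2
      fun q => h.canonicalParam_mem hGI hθbar
    have hb3 := ExpFamily.continuousOn_deriv_b.comp_continuous h2
      fun q => h.canonicalParam_mem hGI hθbar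
    exact (hb1.sub hb2.continuousOn).sub (hb3.continuousOn.mul (h1.sub h2.continuousOn))
  have hnonneg : ∀ x, ∀ θ ∈ M.Θ,
      0 ≤ E.klDiv (E.canonicalParam G f x θbar) (E.canonicalParam G f x θ) := fun x θ hθ =>
    ExpFamily.klDiv_nonneg (h.canonicalParam_mem hGI hθbar) (h.canonicalParam_mem hGI hθ)
  have hpos : ∀ q ∈ S, 0 <
      ∑ j, E.klDiv (E.canonicalParam G f (q.1 j) θbar) (E.canonicalParam G f (q.1 j) q.2) := by
    rintro ⟨z, θ⟩ ⟨⟨-, hθ⟩, hz, hθε⟩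
    refine lt_of_le_of_ne (Finset.sum_nonneg fun j _ => hnonneg _ θ hθ) fun h0 => ?_
    have hz0 : (designMatrix f z).det ≠ 0 := fun h1 => by
      have hz' : d ≤ (designMatrix f z).det ^ 2 := hz
      rw [h1, zero_pow two_ne_zero] at hz'
      linarith
    have hall := (Finset.sum_eq_zero_iff_of_nonneg fun j _ => hnonneg _ θ hθ).1 h0.symm
    have heq : θbar = θ := eq_of_inner_eq_of_det_ne_zero hz0 fun j => by
      refine h.inner_eq_of_canonicalParam_eq hGI hθbar hθ ?_
      by_contra hne
      exact (ExpFamily.klDiv_pos (h.canonicalParam_mem hGI hθbar)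
        (h.canonicalParam_mem hGI hθ) hne).ne' (hall j (Finset.mem_univ j))
    rw [heq, dist_self] at hθε
    linarith
  rcases S.eq_empty_or_nonempty with hem | hne
  · refine ⟨1, one_pos, fun z hz θ hθ hθε => ?_⟩
    have : (z, θ) ∈ S := ⟨⟨trivial, hθ⟩, hz, hθε⟩
    simp [hem] at this
  · obtain ⟨q, hq, hmin⟩ := hS.exists_isMinOn hne hcont
    refine ⟨∑ j, E.klDiv (E.canonicalParam G f (q.1 j) θbar) (E.canonicalParam G f (q.1 j) q.2),
      hpos q hq, fun z hz θ hθ hθε => ?_⟩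
    exact isMinOn_iff.1 hmin (z, θ) ⟨⟨trivial, hθ⟩, hz, hθε⟩

end RegressionModel.GLMStar

/-! ### The likelihood and the sample sizes -/

lemma sampleSize_succ_of_one_le {n₁ p k : ℕ} (hk : 1 ≤ k) :
    sampleSize n₁ p (k + 1) = sampleSize n₁ p k + p := by
  obtain ⟨k, rfl⟩ := Nat.exists_eq_add_of_le' hk
  simp only [sampleSize]
  ring

lemma monotone_sampleSize (n₁ p : ℕ) : Monotone (sampleSize n₁ p) := by
  refine monotone_nat_of_le_succ fun k => ?_
  rcases Nat.eq_zero_or_pos k with rfl | hk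
  · simp [sampleSize]
  · rw [sampleSize_succ_of_one_le hk]
    exact Nat.le_add_right _ _

lemma sampleSize_succ_sub_le (n₁ p k : ℕ) :
    sampleSize n₁ p (k + 1) - sampleSize n₁ p k ≤ n₁ + p := by
  rcases Nat.eq_zero_or_pos k with rfl | hk
  · simp [sampleSize]
  · rw [sampleSize_succ_of_one_le hk]
    omega

/-- A nonnegative sum over the first `k` batches is at least `k - 1` times any lower bound of its
sums over the batches from the second one on. -/
lemma mul_le_sum_range_sampleSize {n₁ p : ℕ} {a : ℕ → ℝ} (ha : ∀ i, 0 ≤ a i) {η : ℝ}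
    (hη : ∀ k, 1 ≤ k → η ≤ ∑ j : Fin p, a (sampleSize n₁ p k + j)) {k : ℕ} (hk : 1 ≤ k) :
    ((k : ℝ) - 1) * η ≤ ∑ i ∈ Finset.range (sampleSize n₁ p k), a i := by
  induction k, hk using Nat.le_induction with
  | base =>
    simp only [Nat.cast_one, sub_self, zero_mul]
    exact Finset.sum_nonneg fun i _ => ha i
  | succ k hk ih =>
    have h1 := hη k hk
    rw [sampleSize_succ_of_one_le hk, Finset.sum_range_add,
      Finset.sum_range fun i => a (sampleSize n₁ p k + i)]
    push_cast
    linarith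

/-- The loss of log-likelihood at `θ` against `θ₀` is the sum of the divergences minus the sum of
the errors weighted by the differences of the canonical parameters. -/
lemma ExpFamily.logLikelihood_sub (E : ExpFamily) {𝒳 : Type*} {p : ℕ} (G : ℝ → ℝ)
    (f : 𝒳 → EuclideanSpace ℝ (Fin p)) (x : ℕ → 𝒳) (y : ℕ → ℝ) (m : ℕ)
    (θ₀ θ : EuclideanSpace ℝ (Fin p)) :
    E.logLikelihood G f (dataUpTo x y m) θ₀ - E.logLikelihood G f (dataUpTo x y m) θ =
      ∑ i ∈ Finset.range m,
        E.klDiv (E.canonicalParam G f (x i) θ₀) (E.canonicalParam G f (x i) θ) -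
      ∑ i ∈ Finset.range m, (E.canonicalParam G f (x i) θ - E.canonicalParam G f (x i) θ₀) *
        (y i - deriv E.b (E.canonicalParam G f (x i) θ₀)) := by
  rw [logLikelihood, logLikelihood, ← Finset.sum_sub_distrib, ← Finset.sum_sub_distrib,
    Finset.sum_range]
  refine Finset.sum_congr rfl fun i _ => ?_
  simp only [dataUpTo, klDiv]
  ring

/-- Under (a2') each single response of a batch has conditional distribution `P_τ`, where `τ` is
its canonical parameter under the true parameter. -/
lemma A2'.condExp_preimage {𝒳 Ω : Type*} {mΩ : MeasurableSpace Ω} {p : ℕ} {μ : Measure Ω}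
    {n₁ : ℕ} {ℱ : Filtration ℕ mΩ} {X : ℕ → Ω → 𝒳} {Y : ℕ → Ω → ℝ} {E : ExpFamily} {G : ℝ → ℝ}
    {f : 𝒳 → EuclideanSpace ℝ (Fin p)} {θbar : EuclideanSpace ℝ (Fin p)}
    (hA2 : A2' μ n₁ ℱ X Y E G f θbar) (hJ : ∀ x, E.canonicalParam G f x θbar ∈ E.J) (k i : ℕ)
    (hi : i ∈ Finset.Ico (sampleSize n₁ p k) (sampleSize n₁ p (k + 1))) (B : Set ℝ)
    (hB : MeasurableSet B) :
    μ⟦Y i ⁻¹' B | ℱ k⟧ =ᵐ[μ] fun ω => (E.P (E.canonicalParam G f (X i ω) θbar)).real B := by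
  have h := hA2 k (Function.eval ⟨i, hi⟩ ⁻¹' B) (measurable_pi_apply _ hB)
  refine h.trans (ae_of_all _ fun ω => ?_)
  have hP : ∀ x, IsProbabilityMeasure (E.P (E.canonicalParam G f x θbar)) := fun x =>
    E.isProbabilityMeasure _ (hJ x)
  exact (measurePreserving_eval (fun i : ↥(Finset.Ico (sampleSize n₁ p k)
    (sampleSize n₁ p (k + 1))) => E.P (E.canonicalParam G f (X i ω) θbar))
    ⟨i, hi⟩).measureReal_preimage hB.nullMeasurableSet

end AdaptiveGLM

/-! ### Strong consistency -/

open AdaptiveGLM in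
theorem mainTheorem3
    {𝒳 : Type*} [MetricSpace 𝒳] [CompactSpace 𝒳] [MeasurableSpace 𝒳] [BorelSpace 𝒳]
    {p : ℕ} (M : AdaptiveGLM.RegressionModel 𝒳 p) (hM : M.Basic)
    -- the exponential family and condition (GLM*) with the Fisher-information weight
    (E : AdaptiveGLM.ExpFamily)
    (ψ : 𝒳 → EuclideanSpace ℝ (Fin p) → ℝ) (f : 𝒳 → EuclideanSpace ℝ (Fin p))
    (I : Set ℝ) (G : ℝ → ℝ) (hGLM : M.GLMStar ψ f I G)
    (hGI : Set.MapsTo G I (deriv E.b '' E.J))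
    (hψ : ∀ x, ∀ θ ∈ M.Θ, ψ x θ = E.fisherWeight G (inner ℝ (f x) θ))
    -- the true parameter and the adaptive stochastic model
    (θbar : EuclideanSpace ℝ (Fin p)) (hθbar : θbar ∈ M.Θ)
    {Ω : Type*} [mΩ : MeasurableSpace Ω] (μ : Measure Ω) [IsProbabilityMeasure μ]
    (n₁ : ℕ) (hn₁ : 1 ≤ n₁)
    (ℱ : Filtration ℕ mΩ) (X : ℕ → Ω → 𝒳) (Y : ℕ → Ω → ℝ)
    (hA1 : AdaptiveGLM.A1 n₁ p ℱ X Y)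
    (hA2 : AdaptiveGLM.A2' μ n₁ ℱ X Y E G f θbar)
    -- the algorithm with arbitrary estimators
    (est : (k : ℕ) → (Fin (AdaptiveGLM.sampleSize n₁ p k) → 𝒳 × ℝ) → EuclideanSpace ℝ (Fin p))
    (hest : ∀ k, 1 ≤ k → ∀ d, est k d ∈ M.Θ)
    (halg : ∀ᵐ ω ∂μ, M.IsAlgorithmPath n₁ est (fun i => X i ω) (fun i => Y i ω))
    -- the adaptive maximum likelihood estimators
    (ml : (k : ℕ) → (Fin (AdaptiveGLM.sampleSize n₁ p k) → 𝒳 × ℝ) → EuclideanSpace ℝ (Fin p))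
    (hml : M.IsMLE n₁ E G f ml) :
    ∀ᵐ ω ∂μ, Tendsto
      (fun k => ml k (AdaptiveGLM.dataUpTo (fun i => X i ω) (fun i => Y i ω)
        (AdaptiveGLM.sampleSize n₁ p k)))
      atTop (𝓝 θbar) := by
  obtain ⟨ω₀⟩ : Nonempty Ω := μ.nonempty_of_neZero
  have : Nonempty 𝒳 := ⟨X 0 ω₀⟩
  obtain ⟨d, hd, hdet⟩ := hGLM.toGLM.exists_le_det_sq hM ⟨θbar, hθbar⟩
  have hJ : ∀ x, E.canonicalParam G f x θbar ∈ E.J := fun x =>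
    hGLM.canonicalParam_mem hGI hθbar
  have hbar := hGLM.continuous_canonicalParam hGI hθbar
  have hcont : ContinuousOn (fun q : 𝒳 × EuclideanSpace ℝ (Fin p) =>
      E.canonicalParam G f q.1 q.2 - E.canonicalParam G f q.1 θbar) (Set.univ ×ˢ M.Θ) :=
    (hGLM.continuousOn_canonicalParam hGI).sub (hbar.comp continuous_fst).continuousOn
  have hnoise := ExpFamily.ae_eventually_forall_sum_mul_error_le (μ := μ) hbar hJ
    (n := sampleSize n₁ p) rfl (monotone_sampleSize n₁ p) (sampleSize_succ_sub_le n₁ p) hA1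
    (fun k i hi B hB => hA2.condExp_preimage hJ k i hi B hB) hM.isCompact_Θ
    (h := fun x θ => E.canonicalParam G f x θ - E.canonicalParam G f x θbar) hcont
  filter_upwards [halg, hnoise] with ω hω hnω
  rw [Metric.tendsto_atTop']
  intro ε hε
  obtain ⟨η, hη, hsep⟩ := hGLM.exists_le_sum_klDiv hGI hM hθbar hd hε
  obtain ⟨K, hK⟩ := eventually_atTop.1 (hnω (η / 4) (by positivity))
  refine ⟨max K 1, fun k hk => ?_⟩
  have hkK : K ≤ k := (le_max_left _ _).trans hk.le
  have hk1 : 1 < k := (le_max_right _ _).trans_lt hk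
  obtain ⟨hθ, hmax⟩ := hml k hk1.le (dataUpTo (fun i => X i ω) (fun i => Y i ω)
    (sampleSize n₁ p k))
  by_contra! hge
  have hlik := isMaxOn_iff.1 hmax θbar hθbar
  have hsub := E.logLikelihood_sub G f (fun i => X i ω) (fun i => Y i ω) (sampleSize n₁ p k) θbar
    (ml k (dataUpTo (fun i => X i ω) (fun i => Y i ω) (sampleSize n₁ p k)))
  have hup := (abs_le.1 (hK k hkK _ hθ)).2
  have hlow := mul_le_sum_range_sampleSize (n₁ := n₁) (p := p) (η := η)
    (a := fun i => E.klDiv (E.canonicalParam G f (X i ω) θbar) (E.canonicalParam G f (X i ω)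
      (ml k (dataUpTo (fun i => X i ω) (fun i => Y i ω) (sampleSize n₁ p k)))))
    (fun i => ExpFamily.klDiv_nonneg (hJ _) (hGLM.canonicalParam_mem hGI hθ))
    (fun l hl => hsep _ (hdet _ (hest l hl _) _ (hω l hl)) _ hθ hge) hk1.le
  -- The divergences exceed `(k - 1) η ≥ k η / 2`, while the weighted errors stay below `k η / 4`.
  have hk2 : (2 : ℝ) ≤ k := by exact_mod_cast hk1
  nlinarith
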